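/- Let $d\ge 1$, let $A=(a_{ij})$ be a complex hermitian $d\times d$ matrix with (real) diagonal entries $a_i:=a_{ii}$, and let $B=\operatorname{diag}(b_1,\dots,b_d)$ with non-negative, mutually different $b_i$. Then there is a unique finite signed measure $\mu^{A,B}$ on $\mathbb R$, carried by $[0,\infty)$, with $$\operatorname{tr}(\exp(A-zB))=\int_{[0,\infty)} e^{-zx}\,\mu^{A,B}(dx)\qquad(z\in\mathbb C),$$ the integrals converging absolutely (the BMV measure of $A,B$), and it decomposes into a singular and an absolutely continuous part $$\mu^{A,B}(dx)=\sum_{i=1}^d e^{a_i}\,\delta_{b_i}(dx)+\psi(x)\,dx ,$$ where $\psi:\mathbb R\to\mathbb R$ is Lebesgue integrable, vanishes outside $[\min_i b_i,\max_i b_i]$, and is piecewise continuous with possible discontinuities only at the $b_i$ (it is continuous on $\mathbb R\setminus\{b_1,\dots,b_d\}$ and has finite one-sided limits at each $b_i$). For $n\ge 2$ let $C_n$ be the set of favorable loops of length $n$, i.e. of all $\gamma\in\{1,\dots,d\}^n$ with $\gamma_k\ne\gamma_{k+1}$ for $1\le k<n$ and $\gamma_n\neq\gamma_1$, and let $C=\bigcup_{n\ge2}C_n$.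 For $\gamma\in C_n$ put $\operatorname{ord}(\gamma)=a_{\gamma_1\gamma_2}a_{\gamma_2\gamma_3}\cdots a_{\gamma_{n-1}\gamma_n}a_{\gamma_n\gamma_1}$. Let $\lambda_n$ be the uniform probability law on $\Delta_n=\{t\in\mathbb R^{n+1}: t_i\ge0,\ \sum_i t_i=1\}$ and, for $g,h\in\mathbb R^{n+1}$, let $\eta^{g;h}$ be the image of the measure $\exp(\sum_i t_ig_i)\,\lambda_n(dt)$ under $t\mapsto\sum_i t_ih_i$. Then for every $\gamma\in C_n$ the measure $$\frac1{n!}\,\eta^{a_{\gamma_1},\dots,a_{\gamma_n},a_{\gamma_1};\;b_{\gamma_1},\dots,b_{\gamma_n},b_{\gamma_1}}$$ has a non-negative Lebesgue density $\phi(\gamma,\cdot)$ that is continuous on $\mathbb R\setminus\{b_1,\dots,b_d\}$ (hence uniquely determined there), and, for a suitable choice of the values of $\psi$ and of the $\phi(\gamma,\cdot)$ at the points $b_i$, $$\psi(x)=\sum_{\gamma\in C}\phi(\gamma,x)\,\operatorname{ord}(\gamma)\qquad(x\in\mathbb R),$$ the series being unconditionally convergent. -/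

import Mathlib

open MeasureTheory Set Filter Topology
open scoped ENNReal

noncomputable section

/-- The BMV function `φ^{A,B}(z) = tr (exp (A - z B))`. -/
def bmvFunction {d : ℕ} (A B : Matrix (Fin d) (Fin d) ℂ) (z : ℂ) : ℂ :=
  (NormedSpace.exp (A - z • B)).trace

/-- `μ` is a BMV measure of `(A, B)`: a (finite) signed measure carried by `[0, ∞)` whose Laplace
transform is the BMV function on all of `ℂ` (absolute convergence of the integral included). -/
structure IsBMVMeasure {d : ℕ} (A B : Matrix (Fin d) (Fin d) ℂ) (μ : SignedMeasure ℝ) : Prop where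
  restrict_Iio : μ.restrict (Iio 0) = 0
  integrable : ∀ z : ℂ, μ.Integrable (fun x : ℝ => Complex.exp (-z * x))
  laplace : ∀ z : ℂ, bmvFunction A B z = ∫ᵛ x : ℝ, Complex.exp (-z * x) ∂<•μ

/-- The set `C_n` of favorable paths (loops) of length `n ≥ 2`: the `n`-tuples of states in which
cyclically neighboring entries are different, the last entry being a neighbor of the first. -/
def favorableLoops (d n : ℕ) : Set (Fin n → Fin d) :=
  {γ | 2 ≤ n ∧ ∀ i, γ (finRotate n i) ≠ γ i}

/-- The set `C` of all favorable loops `⟨n, γ⟩`, `γ ∈ C_n`. -/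
abbrev FavorableLoop (d : ℕ) : Type := Σ n : ℕ, favorableLoops d n

namespace FavorableLoop

variable {d : ℕ}

/-- `ord(γ) = a_{γ₁γ₂} a_{γ₂γ₃} ⋯ a_{γₙγ₁}`. -/
def ord (A : Matrix (Fin d) (Fin d) ℂ) (γ : FavorableLoop d) : ℂ :=
  ∏ i : Fin γ.1, A (γ.2.1 i) (γ.2.1 (finRotate γ.1 i))

/-- The closed word `(γ₁, …, γₙ, γ₁)`. -/
def closedWord (γ : FavorableLoop d) : Fin (γ.1 + 1) → Fin d :=
  Fin.snoc (α := fun _ => Fin d) γ.2.1 (γ.2.1 ⟨0, lt_of_lt_of_le Nat.zero_lt_two γ.2.2.1⟩)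

end FavorableLoop

/-- The uniform probability law `λ_n` on the `n`-simplex
`Δ_n = {t ∈ ℝ^{n+1} | t_i ≥ 0, ∑ t_i = 1}`: the image of `n! dt₁ ⋯ dtₙ` on
`{t ∈ ℝⁿ | t_i ≥ 0, ∑ t_i ≤ 1}` (a set of volume `1 / n!`) under
`t ↦ (t₁, …, tₙ, 1 - t₁ - ⋯ - tₙ)`. -/
def simplexUniform (n : ℕ) : Measure (Fin (n + 1) → ℝ) :=
  ((n.factorial : ℝ≥0∞) •
    (volume : Measure (Fin n → ℝ)).restrict {t : Fin n → ℝ | (∀ i, 0 ≤ t i) ∧ ∑ i, t i ≤ 1}).map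
      (fun t => Fin.snoc (α := fun _ => ℝ) t (1 - ∑ i, t i))

/-- The measure `Q^g` on the simplex, with density `exp (∑ t_i g_i)` with respect to `λ_n`. -/
def tiltedSimplex {n : ℕ} (g : Fin (n + 1) → ℝ) : Measure (Fin (n + 1) → ℝ) :=
  (simplexUniform n).withDensity (fun t => ENNReal.ofReal (Real.exp (∑ i, t i * g i)))

/-- The image measure `η^{g;h}` of `Q^g` under `t ↦ ∑ t_i h_i`. -/
def etaMeasure {n : ℕ} (g h : Fin (n + 1) → ℝ) : Measure ℝ :=
  (tiltedSimplex g).map (fun t => ∑ i, t i * h i)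

/-- `f` is the density `φ(γ, ·)` of `(1/n!) η^{a_{γ₁},…,a_{γₙ},a_{γ₁}; b_{γ₁},…,b_{γₙ},b_{γ₁}}`.
A density is determined only up to null sets; continuity outside `{b₁, …, b_d}` determines it at
every point outside that finite set. -/
structure IsLoopDensity {d : ℕ} (a b : Fin d → ℝ) (γ : FavorableLoop d) (f : ℝ → ℝ) : Prop where
  nonneg : ∀ x, 0 ≤ f x
  continuousOn : ContinuousOn f (range b)ᶜ
  density : (γ.1.factorial : ℝ≥0∞)⁻¹ • etaMeasure (a ∘ γ.closedWord) (b ∘ γ.closedWord)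
    = volume.withDensity (fun x => ENNReal.ofReal (f x))

/-- `f` is piecewise continuous with possible discontinuities only in the finite set `s`:
it is continuous outside `s` and has finite one-sided limits at the points of `s`. -/
structure IsPiecewiseContinuous (f : ℝ → ℝ) (s : Set ℝ) : Prop where
  finite : s.Finite
  continuousOn : ContinuousOn f sᶜ
  leftLim : ∀ x ∈ s, ∃ l, Tendsto f (𝓝[<] x) (𝓝 l)
  rightLim : ∀ x ∈ s, ∃ l, Tendsto f (𝓝[>] x) (𝓝 l)

end

/-!
Write `A - z B = D + V` with `D = diag (aᵢ - z bᵢ)` and `V` the off-diagonal part of `A`. Iterating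
Duhamel's formula gives the Dyson series of `exp (D + V)`, whose `n`-th term is a sum over words
`w₀ ⋯ wₙ` of the product of the entries of `V` along the word and of the integral
`∫ exp (∑ tᵢ (a_{wᵢ} - z b_{wᵢ}))` over the simplex `tᵢ ≥ 0`, `∑ tᵢ = 1` of holding times
(`hasSum_exp_diagonal_add`). In the trace only closed words survive. As `V` has zero diagonal,
these are the constant words of length one, which contribute `∑ exp (aᵢ - z bᵢ)`, that is, the
point masses, and the favorable loops (`trace_exp_diagonal_add_eq_tsum`).

The simplex integral of a loop is the Laplace transform of the image measure `η / n!`, and the point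
is to understand its density. Conditioning on the time at which the last state of the path is
entered yields a recursion in the number of states, which defines `pathDensity`; it starts with two
states, where the density is explicit because the first two states of a favorable loop have
different values of `b`. All properties follow from the recursion by induction: nonnegativity, the
support, the bound `C exp G / (n - 1)!` (`pathDensity_le`), continuity off the `bᵢ`
(`continuousAt_pathDensity`) and the existence of one-sided limits everywhere
(`exists_tendsto_pathDensity_nhdsGT`), the last two by dominated convergence; moreover it is the
density of `η / n!` (`inv_factorial_smul_etaMeasure`) and its Laplace transform is the simplex
integral (`integral_exp_mul_pathDensity`), both by Tonelli and Fubini.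

The factorial in the bound dominates the exponential number of loops and the size of `ord`, so
the loop series converges absolutely and uniformly, inherits the regularity of its terms, and may be
integrated term by term. It is real since `tr exp (A - z̄ B)` is the conjugate of
`tr exp (A - z B)`, so that the Fourier transform of its imaginary part vanishes (`loopSeries_im`).
Uniqueness of the BMV measure is injectivity of the Fourier transform, the restriction of the
Laplace transform to the imaginary axis (`SignedMeasure.ext_of_integral_exp`). The free values at
the points `bᵢ` of all densities, hence of their series, are chosen to be `0`.
-/

/-! ### Densities of occupation functionals -/

/-- `pathDensity n g h s` is the Lebesgue density of the occupation functional of a path which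
visits `n + 1` states in a fixed order during the time `s`: it is the density of the image, under
`t ↦ ∑ tᵢ hᵢ`, of the measure `exp (∑ tᵢ gᵢ) dt₀ ⋯ dtₙ₋₁` on the simplex
`{t ∈ ℝⁿ⁺¹ | tᵢ ≥ 0, ∑ tᵢ = s}`.  Conditioning on the time `u` at which the last state is entered
gives the recursion.  For `n = 0` the image measure is a point mass and the value is a dummy; for
`n = 1` the formula is meaningful if `h 0 ≠ h 1`; otherwise the junk value `0⁻¹ = 0` makes it `0`. -/
noncomputable def pathDensity :
    (n : ℕ) → (Fin (n + 1) → ℝ) → (Fin (n + 1) → ℝ) → ℝ → ℝ → ℝ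
  | 0, _, _, _, _ => 0
  | 1, g, h, s, x =>
      (Icc 0 s).indicator (fun t => Real.exp (t * g 0 + (s - t) * g 1) * |h 0 - h 1|⁻¹)
        ((x - s * h 1) / (h 0 - h 1))
  | n + 2, g, h, s, x =>
      ∫ u in Ioc 0 s, Real.exp ((s - u) * g (Fin.last _)) *
        pathDensity (n + 1) (Fin.init g) (Fin.init h) u (x - (s - u) * h (Fin.last _))

lemma pathDensity_one (g h : Fin 2 → ℝ) (s x : ℝ) : pathDensity 1 g h s x =
    (Icc 0 s).indicator (fun t => Real.exp (t * g 0 + (s - t) * g 1) * |h 0 - h 1|⁻¹)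
        ((x - s * h 1) / (h 0 - h 1)) := by
  rw [pathDensity]

lemma pathDensity_add_two (n : ℕ) (g h : Fin (n + 3) → ℝ) (s x : ℝ) :
    pathDensity (n + 2) g h s x = ∫ u in Ioc 0 s, Real.exp ((s - u) * g (Fin.last _)) *
      pathDensity (n + 1) (Fin.init g) (Fin.init h) u (x - (s - u) * h (Fin.last _)) := by
  rw [pathDensity]

lemma pathDensity_nonneg : ∀ (n : ℕ) (g h : Fin (n + 1) → ℝ) (s x : ℝ),
    0 ≤ pathDensity n g h s x
  | 0, _, _, _, _ => by simp [pathDensity]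
  | 1, g, h, s, x => by
      rw [pathDensity_one]
      exact indicator_nonneg (fun t _ => by positivity) _
  | n + 2, g, h, s, x => by
      rw [pathDensity_add_two]
      exact integral_nonneg fun u => mul_nonneg (Real.exp_nonneg _) (pathDensity_nonneg _ _ _ _ _)

lemma measurable_pathDensity : ∀ (n : ℕ) (g h : Fin (n + 1) → ℝ),
    Measurable fun p : ℝ × ℝ => pathDensity n g h p.1 p.2
  | 0, _, _ => by simp [pathDensity]
  | 1, g, h => by
      simp only [pathDensity_one, indicator]
      refine Measurable.ite ?_ (by fun_prop) measurable_const
      exact (measurableSet_le (f := fun _ : ℝ × ℝ => (0 : ℝ))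
          (g := fun p : ℝ × ℝ => (p.2 - p.1 * h 1) / (h 0 - h 1)) (by fun_prop) (by fun_prop)).inter
        (measurableSet_le (f := fun p : ℝ × ℝ => (p.2 - p.1 * h 1) / (h 0 - h 1))
          (g := fun p : ℝ × ℝ => p.1) (by fun_prop) (by fun_prop))
  | n + 2, g, h => by
      have ih := measurable_pathDensity (n + 1) (Fin.init g) (Fin.init h)
      have hF : Measurable fun q : (ℝ × ℝ) × ℝ => Real.exp ((q.1.1 - q.2) * g (Fin.last _)) *
          pathDensity (n + 1) (Fin.init g) (Fin.init h) q.2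
            (q.1.2 - (q.1.1 - q.2) * h (Fin.last _)) := by
        refine Measurable.mul (by fun_prop) ?_
        exact ih.comp (g := fun p : ℝ × ℝ => pathDensity (n + 1) (Fin.init g) (Fin.init h) p.1 p.2)
          (f := fun q : (ℝ × ℝ) × ℝ => (q.2, q.1.2 - (q.1.1 - q.2) * h (Fin.last _)))
          (by fun_prop)
      have hS : MeasurableSet {q : (ℝ × ℝ) × ℝ | q.2 ∈ Ioc 0 q.1.1} :=
        (measurableSet_lt (f := fun _ : (ℝ × ℝ) × ℝ => (0 : ℝ)) (g := fun q => q.2)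
          (by fun_prop) (by fun_prop)).inter
        (measurableSet_le (f := fun q : (ℝ × ℝ) × ℝ => q.2) (g := fun q => q.1.1)
          (by fun_prop) (by fun_prop))
      have := (hF.indicator hS).stronglyMeasurable.integral_prod_right'
        (ν := (volume : Measure ℝ))
      convert! this.measurable using 1
      ext p
      rw [pathDensity_add_two, ← integral_indicator measurableSet_Ioc]
      rfl

lemma measurable_pathDensity_comp (n : ℕ) (g h : Fin (n + 1) → ℝ) {α : Type*} [MeasurableSpace α]
    {f₁ f₂ : α → ℝ} (h₁ : Measurable f₁) (h₂ : Measurable f₂) :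
    Measurable fun a => pathDensity n g h (f₁ a) (f₂ a) :=
  (measurable_pathDensity n g h).comp (h₁.prodMk h₂)

/-- The volume of the simplex bounds the density; with `s ^ n / n!` the sum over all loops will
converge. -/
lemma pathDensity_le {G : ℝ} : ∀ (n : ℕ) (g h : Fin (n + 2) → ℝ) (_ : ∀ i, g i ≤ G) {s : ℝ}
    (_ : 0 ≤ s) (x : ℝ),
    pathDensity (n + 1) g h s x ≤ |h 0 - h 1|⁻¹ * Real.exp (s * G) * (s ^ n / n.factorial)
  | 0, g, h, hg, s, hs, x => by
      rw [pathDensity_one]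
      refine indicator_apply_le' (fun ht => ?_) (fun _ => by positivity)
      set t := (x - s * h 1) / (h 0 - h 1)
      have : t * g 0 + (s - t) * g 1 ≤ s * G := by
        nlinarith [mul_le_mul_of_nonneg_left (hg 0) ht.1,
          mul_le_mul_of_nonneg_left (hg 1) (sub_nonneg.2 ht.2)]
      simp only [pow_zero, Nat.factorial_zero, Nat.cast_one, div_one, mul_one]
      rw [mul_comm]
      gcongr
  | n + 1, g, h, hg, s, hs, x => by
      have ih : ∀ u ∈ Ioc 0 s, Real.exp ((s - u) * g (Fin.last _)) *
          pathDensity (n + 1) (Fin.init g) (Fin.init h) u (x - (s - u) * h (Fin.last _)) ≤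
          |h 0 - h 1|⁻¹ * Real.exp (s * G) * (u ^ n / n.factorial) := by
        intro u hu
        have h1 := pathDensity_le n (Fin.init g) (Fin.init h) (fun i => hg _) hu.1.le
          (x - (s - u) * h (Fin.last _))
        have h2 : Real.exp ((s - u) * g (Fin.last _)) ≤ Real.exp ((s - u) * G) := by
          gcongr
          · linarith [hu.2]
          · exact hg _
        calc _ ≤ Real.exp ((s - u) * G) * (|h 0 - h 1|⁻¹ * Real.exp (u * G) *
              (u ^ n / n.factorial)) :=
              mul_le_mul h2 h1 (pathDensity_nonneg _ _ _ _ _) (Real.exp_nonneg _)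
          _ = _ := by
              have : Real.exp (s * G) = Real.exp ((s - u) * G) * Real.exp (u * G) := by
                rw [← Real.exp_add]; ring_nf
              rw [this]; ring
      have hint : IntegrableOn (fun u : ℝ => |h 0 - h 1|⁻¹ * Real.exp (s * G) *
          (u ^ n / n.factorial)) (Ioc 0 s) :=
        (Continuous.integrableOn_Icc (by fun_prop)).mono_set Ioc_subset_Icc_self
      rw [pathDensity_add_two]
      calc _ ≤ ∫ u in Ioc 0 s, |h 0 - h 1|⁻¹ * Real.exp (s * G) * (u ^ n / n.factorial) := by
            refine setIntegral_mono_on (hint.mono' ?_ ?_) hint measurableSet_Ioc ih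
            · exact ((Measurable.mul (by fun_prop) (measurable_pathDensity_comp _ _ _
                measurable_id (by fun_prop)))).aestronglyMeasurable
            · refine (ae_restrict_iff' measurableSet_Ioc).2 (ae_of_all _ fun u hu => ?_)
              rw [Real.norm_of_nonneg (mul_nonneg (Real.exp_nonneg _)
                (pathDensity_nonneg _ _ _ _ _))]
              exact ih u hu
        _ = _ := by
            rw [← intervalIntegral.integral_of_le hs, intervalIntegral.integral_const_mul,
              intervalIntegral.integral_div, integral_pow, Nat.factorial_succ]
            push_cast
            field_simp
            ring

lemma integrableOn_pathDensity_integrand (n : ℕ) (g h : Fin (n + 3) → ℝ) (s x : ℝ) :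
    IntegrableOn (fun u => Real.exp ((s - u) * g (Fin.last _)) *
      pathDensity (n + 1) (Fin.init g) (Fin.init h) u (x - (s - u) * h (Fin.last _)))
      (Ioc 0 s) := by
  obtain ⟨G, hG⟩ := (Set.finite_range g).bddAbove
  refine Integrable.mono' (g := fun u => Real.exp ((s - u) * g (Fin.last _)) *
    (|h 0 - h 1|⁻¹ * Real.exp (u * G) * (u ^ n / n.factorial))) ?_ ?_ ?_
  · exact (Continuous.integrableOn_Icc (by fun_prop)).mono_set Ioc_subset_Icc_self
  · exact ((Measurable.mul (by fun_prop)
      (measurable_pathDensity_comp _ _ _ measurable_id (by fun_prop)))).aestronglyMeasurable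
  · refine (ae_restrict_iff' measurableSet_Ioc).2 (ae_of_all _ fun u hu => ?_)
    rw [Real.norm_of_nonneg (mul_nonneg (Real.exp_nonneg _) (pathDensity_nonneg _ _ _ _ _))]
    exact mul_le_mul_of_nonneg_left (pathDensity_le n (Fin.init g) (Fin.init h)
      (fun i => hG (mem_range_self _)) hu.1.le _) (Real.exp_nonneg _)

/-- Occupation functionals are weighted means: the density vanishes outside the interval spanned by
the values `s * h i`. -/
lemma pathDensity_eq_zero {lo hi : ℝ} : ∀ (n : ℕ) (g h : Fin (n + 1) → ℝ)
    (_ : ∀ i, h i ∈ Icc lo hi) {s x : ℝ} (_ : x ∉ Icc (s * lo) (s * hi)),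
    pathDensity n g h s x = 0
  | 0, _, _, _, _, _, _ => by simp [pathDensity]
  | 1, g, h, hh, s, x, hx => by
      rw [pathDensity_one]
      by_cases h01 : h 0 - h 1 = 0
      · simp [h01, indicator]
      refine indicator_of_notMem (fun ht => hx ?_) _
      set t := (x - s * h 1) / (h 0 - h 1) with htdef
      have hxt : x = t * h 0 + (s - t) * h 1 := by
        rw [htdef]; field_simp; ring
      have ht2 := sub_nonneg.2 ht.2
      constructor <;> nlinarith [mul_le_mul_of_nonneg_left (hh 0).1 ht.1,
        mul_le_mul_of_nonneg_left (hh 1).1 ht2, mul_le_mul_of_nonneg_left (hh 0).2 ht.1,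
        mul_le_mul_of_nonneg_left (hh 1).2 ht2]
  | n + 2, g, h, hh, s, x, hx => by
      rw [pathDensity_add_two]
      refine setIntegral_eq_zero_of_forall_eq_zero fun u hu => ?_
      rw [pathDensity_eq_zero (n + 1) (Fin.init g) (Fin.init h) (fun i => hh _), mul_zero]
      intro hu'
      have h2 := sub_nonneg.2 hu.2
      refine hx ⟨?_, ?_⟩ <;> nlinarith [hu'.1, hu'.2,
        mul_le_mul_of_nonneg_left (hh (Fin.last _)).1 h2,
        mul_le_mul_of_nonneg_left (hh (Fin.last _)).2 h2]

/-- Dominated convergence in the recursion for `pathDensity`: the only analytic input needed to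
pass to limits in the space variable. -/
lemma tendsto_pathDensity_add_two (n : ℕ) (g h : Fin (n + 3) → ℝ) (s : ℝ) {l : Filter ℝ}
    [l.IsCountablyGenerated] {L : ℝ → ℝ}
    (hL : ∀ᵐ u ∂(volume.restrict (Ioc 0 s)), Tendsto (fun x => pathDensity (n + 1) (Fin.init g)
      (Fin.init h) u (x - (s - u) * h (Fin.last _))) l (𝓝 (L u))) :
    Tendsto (pathDensity (n + 2) g h s) l
      (𝓝 (∫ u in Ioc 0 s, Real.exp ((s - u) * g (Fin.last _)) * L u)) := by
  obtain ⟨G, hG⟩ : ∃ G, ∀ i, g i ≤ G := by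
    obtain ⟨G, hG⟩ := (Set.finite_range g).bddAbove
    exact ⟨G, fun i => hG (mem_range_self i)⟩
  simp_rw [funext (pathDensity_add_two n g h s)]
  refine tendsto_integral_filter_of_dominated_convergence
    (fun u => Real.exp ((s - u) * g (Fin.last _)) *
      (|h 0 - h 1|⁻¹ * Real.exp (u * G) * (u ^ n / n.factorial))) ?_ ?_ ?_ ?_
  · exact Eventually.of_forall fun x => ((Measurable.mul (by fun_prop)
      (measurable_pathDensity_comp _ _ _ measurable_id (by fun_prop)))).aestronglyMeasurable
  · refine Eventually.of_forall fun x => (ae_restrict_iff' measurableSet_Ioc).2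
      (ae_of_all _ fun u hu => ?_)
    rw [Real.norm_of_nonneg (mul_nonneg (Real.exp_nonneg _) (pathDensity_nonneg _ _ _ _ _))]
    exact mul_le_mul_of_nonneg_left (pathDensity_le n (Fin.init g) (Fin.init h) (fun i => hG _)
      hu.1.le _) (Real.exp_nonneg _)
  · exact (Continuous.integrableOn_Icc (by fun_prop)).mono_set Ioc_subset_Icc_self
  · filter_upwards [hL] with u hu using hu.const_mul _

lemma continuousAt_pathDensity : ∀ (n : ℕ) (g h : Fin (n + 1) → ℝ) {s x : ℝ}
    (_ : ∀ i, x ≠ s * h i), ContinuousAt (pathDensity n g h s) x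
  | 0, g, h, s, x, _ => by
      rw [show pathDensity 0 g h s = fun _ => 0 from funext fun y => by simp [pathDensity]]
      exact continuousAt_const
  | 1, g, h, s, x, hx => by
      rw [funext (pathDensity_one g h s)]
      by_cases h01 : h 0 - h 1 = 0
      · simp only [h01, abs_zero, inv_zero, mul_zero, indicator_zero]
        exact (continuousAt_const : ContinuousAt (fun _ : ℝ => (0 : ℝ)) x)
      have hc : ContinuousAt (fun y => (y - s * h 1) / (h 0 - h 1)) x := by fun_prop
      refine ContinuousAt.comp (f := fun y => (y - s * h 1) / (h 0 - h 1))
        (g := (Icc 0 s).indicator fun t => Real.exp (t * g 0 + (s - t) * g 1) * |h 0 - h 1|⁻¹)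
        ?_ hc
      have h0 : (x - s * h 1) / (h 0 - h 1) ≠ 0 :=
        div_ne_zero (sub_ne_zero.2 (hx 1)) h01
      have h1 : (x - s * h 1) / (h 0 - h 1) ≠ s := by
        intro h
        rw [div_eq_iff h01] at h
        exact hx 0 (by linarith)
      generalize (x - s * h 1) / (h 0 - h 1) = t at h0 h1
      by_cases ht : t ∈ Icc 0 s
      · have : Icc 0 s ∈ 𝓝 t :=
          Icc_mem_nhds (lt_of_le_of_ne ht.1 h0.symm) (lt_of_le_of_ne ht.2 h1)
        refine ContinuousAt.congr (f := fun t => Real.exp (t * g 0 + (s - t) * g 1) *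
          |h 0 - h 1|⁻¹) (by fun_prop) ?_
        filter_upwards [this] with y hy
        rw [indicator_of_mem hy]
      · have : (Icc 0 s)ᶜ ∈ 𝓝 t := isClosed_Icc.isOpen_compl.mem_nhds ht
        refine ContinuousAt.congr (f := fun _ => (0 : ℝ)) continuousAt_const ?_
        filter_upwards [this] with y hy
        rw [indicator_of_notMem hy]
  | n + 2, g, h, s, x, hx => by
      have key : ∀ᵐ u ∂(volume.restrict (Ioc 0 s)), Tendsto (fun x => pathDensity (n + 1)
          (Fin.init g) (Fin.init h) u (x - (s - u) * h (Fin.last _))) (𝓝 x)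
          (𝓝 (pathDensity (n + 1)
            (Fin.init g) (Fin.init h) u (x - (s - u) * h (Fin.last _)))) := by
        -- The line `u ↦ (u, x - (s - u) * h_last)` meets each of the rays `y = u * h i` at most
        -- once, since the two can only be parallel if they are disjoint.
        have hbad : (⋃ i : Fin (n + 2),
            {u : ℝ | x - (s - u) * h (Fin.last _) = u * Fin.init h i}).Finite := by
          refine finite_iUnion fun i => Set.Subsingleton.finite ?_
          intro u hu v hv
          simp only [mem_ofPred_eq] at hu hv
          have hne : h (Fin.last _) - Fin.init h i ≠ 0 := by
            intro h0
            refine hx (Fin.last _) ?_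
            rw [sub_eq_zero] at h0
            rw [← h0] at hu
            linarith
          have : (u - v) * (h (Fin.last _) - Fin.init h i) = 0 := by linarith
          rcases mul_eq_zero.1 this with h' | h'
          · linarith
          · exact absurd h' hne
        have hae := ae_restrict_of_ae (s := Ioc 0 s) (compl_mem_ae_iff.2 (hbad.measure_zero volume))
        filter_upwards [hae] with u hu
        have hcont := continuousAt_pathDensity (n + 1) (Fin.init g) (Fin.init h)
          (s := u) (x := x - (s - u) * h (Fin.last _)) (fun i hi => hu (mem_iUnion.2 ⟨i, hi⟩))
        exact hcont.tendsto.comp (Continuous.tendsto' (by fun_prop) _ _ rfl)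
      have := tendsto_pathDensity_add_two n g h s key
      rwa [← pathDensity_add_two] at this

/-- Reflection of the line; it turns left limits into right limits. -/
lemma pathDensity_neg : ∀ (n : ℕ) (g h : Fin (n + 1) → ℝ) (s x : ℝ),
    pathDensity n g (-h) s (-x) = pathDensity n g h s x
  | 0, _, _, _, _ => by simp [pathDensity]
  | 1, g, h, s, x => by
      rw [pathDensity_one, pathDensity_one]
      have h1 : (-x - s * (-h) 1) / ((-h) 0 - (-h) 1) = (x - s * h 1) / (h 0 - h 1) := by
        rw [← neg_div_neg_eq]; simp only [Pi.neg_apply]; ring_nf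
      have h2 : |(-h) 0 - (-h) 1| = |h 0 - h 1| := by
        rw [← abs_neg]; simp only [Pi.neg_apply]; ring_nf
      rw [h1, h2]
  | n + 2, g, h, s, x => by
      rw [pathDensity_add_two, pathDensity_add_two]
      congr 1
      ext u
      rw [← pathDensity_neg (n + 1) (Fin.init g) (Fin.init h)]
      congr 2
      simp only [Pi.neg_apply]
      ring

lemma Set.OrdConnected.eventually_mem_or_eventually_notMem {E : Set ℝ} (hE : E.OrdConnected)
    (x : ℝ) : (∀ᶠ y in 𝓝[>] x, y ∈ E) ∨ (∀ᶠ y in 𝓝[>] x, y ∉ E) := by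
  by_contra! hcon
  obtain ⟨h1, h2⟩ := hcon
  obtain ⟨z, hz, hxz⟩ := (h2.and_eventually self_mem_nhdsWithin).exists
  refine h1 ?_
  filter_upwards [Ioo_mem_nhdsGT (mem_Ioi.1 hxz)] with y hy
  obtain ⟨w, hw, hxw⟩ := (h2.and_eventually (Ioo_mem_nhdsGT hy.1)).exists
  exact fun hyE => hyE (hE.out hw hz ⟨hxw.2.le, hy.2.le⟩)

lemma exists_tendsto_pathDensity_nhdsGT : ∀ (n : ℕ) (g h : Fin (n + 1) → ℝ) (s x : ℝ),
    ∃ l, Tendsto (pathDensity n g h s) (𝓝[>] x) (𝓝 l)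
  | 0, g, h, s, x => by
      rw [show pathDensity 0 g h s = fun _ => 0 from funext fun y => by simp [pathDensity]]
      exact ⟨0, tendsto_const_nhds⟩
  | 1, g, h, s, x => by
      rw [funext (pathDensity_one g h s)]
      have hE : ((fun y => (y - s * h 1) / (h 0 - h 1)) ⁻¹' Icc 0 s).OrdConnected := by
        rcases le_total 0 (h 0 - h 1) with h' | h'
        · exact ordConnected_Icc.preimage_mono fun y z hyz => by gcongr
        · exact ordConnected_Icc.preimage_anti fun y z hyz =>
            div_le_div_of_nonpos_of_le h' (by linarith)
      rcases hE.eventually_mem_or_eventually_notMem x with h' | h'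
      · refine ⟨_, Tendsto.congr' (f₁ := fun y => Real.exp ((y - s * h 1) / (h 0 - h 1) * g 0 +
          (s - (y - s * h 1) / (h 0 - h 1)) * g 1) * |h 0 - h 1|⁻¹) ?_
          ((Continuous.tendsto (by fun_prop) x).mono_left nhdsWithin_le_nhds)⟩
        filter_upwards [h'] with y hy
        rw [indicator_of_mem (by exact hy)]
      · refine ⟨0, Tendsto.congr' (f₁ := fun y => 0) ?_ tendsto_const_nhds⟩
        filter_upwards [h'] with y hy
        rw [indicator_of_notMem (by exact hy)]
  | n + 2, g, h, s, x => by
      choose L hL using fun u : ℝ => exists_tendsto_pathDensity_nhdsGT (n + 1) (Fin.init g)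
        (Fin.init h) u (x - (s - u) * h (Fin.last _))
      refine ⟨_, tendsto_pathDensity_add_two n g h s (L := L) (ae_of_all _ fun u => ?_)⟩
      refine (hL u).comp (tendsto_nhdsWithin_iff.2 ⟨?_, ?_⟩)
      · exact (Continuous.tendsto' (by fun_prop) _ _ rfl).mono_left nhdsWithin_le_nhds
      · filter_upwards [self_mem_nhdsWithin] with y hy
        exact sub_lt_sub_right (mem_Ioi.1 hy) _

lemma exists_tendsto_pathDensity_nhdsLT (n : ℕ) (g h : Fin (n + 1) → ℝ) (s x : ℝ) :
    ∃ l, Tendsto (pathDensity n g h s) (𝓝[<] x) (𝓝 l) := by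
  obtain ⟨l, hl⟩ := exists_tendsto_pathDensity_nhdsGT n g (-h) s (-x)
  refine ⟨l, (hl.comp tendsto_neg_nhdsLT).congr fun y => ?_⟩
  exact pathDensity_neg n g h s y

/-! ### The density of the image of the simplex measure -/

/-- The simplex `{t ∈ ℝⁿ | tᵢ ≥ 0, ∑ tᵢ ≤ s}`, the projection to the first `n` coordinates of the
set of holding times of a path with `n + 1` states and total time `s`. -/
def cornerSimplex (n : ℕ) (s : ℝ) : Set (Fin n → ℝ) := {t | (∀ i, 0 ≤ t i) ∧ ∑ i, t i ≤ s}

/-- The holding times `(t₀, …, tₙ₋₁, s - ∑ tᵢ)` with total time `s`. -/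
def holdingTimes {n : ℕ} (s : ℝ) (t : Fin n → ℝ) : Fin (n + 1) → ℝ :=
  Fin.snoc (α := fun _ => ℝ) t (s - ∑ i, t i)

lemma measurableSet_cornerSimplex (n : ℕ) (s : ℝ) : MeasurableSet (cornerSimplex n s) := by
  have h₁ : MeasurableSet {t : Fin n → ℝ | ∀ i, 0 ≤ t i} :=
    (measurableSet_Ici : MeasurableSet (Ici (0 : Fin n → ℝ)))
  have h₂ : MeasurableSet {t : Fin n → ℝ | ∑ i, t i ≤ s} :=
    measurableSet_le (by fun_prop) (by fun_prop)
  exact h₁.inter h₂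

lemma sum_holdingTimes_mul {n : ℕ} (s : ℝ) (t : Fin n → ℝ) (h : Fin (n + 1) → ℝ) :
    ∑ i, holdingTimes s t i * h i =
      ∑ i, t i * Fin.init h i + (s - ∑ i, t i) * h (Fin.last n) := by
  simp [Fin.sum_univ_castSucc, holdingTimes, Fin.init]

lemma measurable_holdingTimes {n : ℕ} (s : ℝ) :
    Measurable (holdingTimes s : (Fin n → ℝ) → Fin (n + 1) → ℝ) := by
  refine measurable_pi_lambda _ fun i => ?_
  refine Fin.lastCases ?_ (fun j => ?_) i
  · simp only [holdingTimes, Fin.snoc_last]; fun_prop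
  · simp only [holdingTimes, Fin.snoc_castSucc]; fun_prop

/-- The integral of `F` against the image of `exp (∑ tᵢ gᵢ) dt₀ ⋯ dtₙ₋₁` on the simplex of size `s`
under `t ↦ ∑ tᵢ hᵢ`. -/
noncomputable def occupationLIntegral {n : ℕ} (g h : Fin (n + 1) → ℝ) (s : ℝ) (F : ℝ → ℝ≥0∞) :
    ℝ≥0∞ :=
  ∫⁻ t in cornerSimplex n s, ENNReal.ofReal (Real.exp (∑ i, holdingTimes s t i * g i)) *
    F (∑ i, holdingTimes s t i * h i)

lemma simplexUniform_eq (n : ℕ) : simplexUniform n =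
    ((n.factorial : ℝ≥0∞) • volume.restrict (cornerSimplex n 1)).map (holdingTimes 1) := rfl

lemma lintegral_comp_mul_add (F : ℝ → ℝ≥0∞) {c : ℝ} (hc : c ≠ 0) (d : ℝ) :
    ∫⁻ t, F (t * c + d) = ENNReal.ofReal |c|⁻¹ * ∫⁻ x, F x := by
  have h1 : ∫⁻ t, F (t * c + d) = ∫⁻ t, F (t + d) ∂(Measure.map (· * c) volume) :=
    (lintegral_map_equiv (fun t => F (t + d)) (MeasurableEquiv.mulRight₀ c hc)).symm
  rw [h1, Real.map_volume_mul_right hc, lintegral_smul_measure, lintegral_add_right_eq_self F d,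
    abs_inv, smul_eq_mul]

lemma cornerSimplex_zero {s : ℝ} (hs : 0 ≤ s) : cornerSimplex 0 s = univ := by
  ext t; simp [cornerSimplex, hs]

lemma occupationLIntegral_zero (g h : Fin 1 → ℝ) {s : ℝ} (hs : 0 ≤ s) (F : ℝ → ℝ≥0∞) :
    occupationLIntegral g h s F = ENNReal.ofReal (Real.exp (s * g 0)) * F (s * h 0) := by
  rw [occupationLIntegral, cornerSimplex_zero hs, Measure.restrict_univ, lintegral_unique]
  simp_rw [sum_holdingTimes_mul]
  simp [volume_pi]

/-- Conditioning on the time `u` at which the last state is entered. -/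
lemma occupationLIntegral_succ (n : ℕ) (g h : Fin (n + 2) → ℝ) (s : ℝ) {F : ℝ → ℝ≥0∞}
    (hF : Measurable F) :
    occupationLIntegral g h s F =
      ∫⁻ u in Ioc 0 s, ENNReal.ofReal (Real.exp ((s - u) * g (Fin.last _))) *
        occupationLIntegral (Fin.init g) (Fin.init h) u
          (fun y => F (y + (s - u) * h (Fin.last _))) := by
  set Φ : (Fin (n + 1) → ℝ) → ℝ≥0∞ := (cornerSimplex (n + 1) s).indicator fun t =>
    ENNReal.ofReal (Real.exp (∑ i, holdingTimes s t i * g i)) *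
      F (∑ i, holdingTimes s t i * h i) with hΦ
  have hmeas : ∀ h : Fin (n + 2) → ℝ, Measurable fun t : Fin (n + 1) → ℝ =>
      ∑ i, holdingTimes s t i * h i := fun h =>
    Finset.measurable_sum _ fun i _ =>
      ((measurable_pi_apply i).comp (measurable_holdingTimes s)).mul_const _
  have hΦm : Measurable Φ := by
    refine Measurable.indicator ?_ (measurableSet_cornerSimplex _ _)
    exact ((hmeas g).exp.ennreal_ofReal).mul (hF.comp (hmeas h))
  have hsnoc : Measurable fun p : ℝ × (Fin n → ℝ) =>
      (Fin.snoc (α := fun _ => ℝ) p.2 (p.1 - ∑ i, p.2 i) : Fin (n + 1) → ℝ) := by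
    refine measurable_pi_lambda _ fun i => ?_
    refine Fin.lastCases ?_ (fun j => ?_) i
    · simp only [Fin.snoc_last]; fun_prop
    · simp only [Fin.snoc_castSucc]; fun_prop
  have hind : ∀ (u : ℝ) (t : Fin n → ℝ), Φ (Fin.snoc (α := fun _ => ℝ) t (u - ∑ i, t i)) =
      (Icc 0 s).indicator (fun u => ENNReal.ofReal (Real.exp ((s - u) * g (Fin.last _))) *
        (cornerSimplex n u).indicator (fun t =>
          ENNReal.ofReal (Real.exp (∑ i, holdingTimes u t i * Fin.init g i)) *
          F (∑ i, holdingTimes u t i * Fin.init h i + (s - u) * h (Fin.last _))) t) u := by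
    intro u t
    have hsum : ∑ i, (Fin.snoc (α := fun _ => ℝ) t (u - ∑ i, t i) : Fin (n + 1) → ℝ) i = u := by
      simp [Fin.sum_univ_castSucc]
    have hmem : (Fin.snoc (α := fun _ => ℝ) t (u - ∑ i, t i) : Fin (n + 1) → ℝ) ∈
        cornerSimplex (n + 1) s ↔ u ∈ Icc 0 s ∧ t ∈ cornerSimplex n u := by
      simp only [cornerSimplex, mem_ofPred_eq, hsum, Fin.forall_fin_succ', Fin.snoc_castSucc,
        Fin.snoc_last, sub_nonneg, mem_Icc]
      constructor
      · rintro ⟨⟨h1, h2⟩, h3⟩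
        exact ⟨⟨(Finset.sum_nonneg fun i _ => h1 i).trans h2, h3⟩, h1, h2⟩
      · rintro ⟨⟨_, h3⟩, h1, h2⟩
        exact ⟨⟨h1, h2⟩, h3⟩
    by_cases hu : u ∈ Icc 0 s
    · by_cases ht : t ∈ cornerSimplex n u
      · rw [hΦ, indicator_of_mem (hmem.2 ⟨hu, ht⟩), indicator_of_mem hu, indicator_of_mem ht,
          sum_holdingTimes_mul s, sum_holdingTimes_mul s, hsum, ← mul_assoc,
          ← ENNReal.ofReal_mul (Real.exp_nonneg _), ← Real.exp_add,
          add_comm ((s - u) * g (Fin.last _))]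
        rfl
      · rw [hΦ, indicator_of_notMem (fun h => ht (hmem.1 h).2), indicator_of_mem hu,
          indicator_of_notMem ht, mul_zero]
    · rw [hΦ, indicator_of_notMem (fun h => hu (hmem.1 h).1), indicator_of_notMem hu]
  calc occupationLIntegral g h s F = ∫⁻ t, Φ t := by
        rw [hΦ, lintegral_indicator (measurableSet_cornerSimplex _ _)]
        rfl
    _ = ∫⁻ p : ℝ × (Fin n → ℝ), Φ (Fin.snoc (α := fun _ => ℝ) p.2 p.1) := by
        have := ((volume_preserving_piFinSuccAbove (fun _ : Fin (n + 1) => ℝ)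
          (Fin.last n)).symm).lintegral_map_equiv Φ
        rw [this]
        refine lintegral_congr fun p => ?_
        congr 1
        exact Fin.insertNth_last' _ _
    _ = ∫⁻ t : Fin n → ℝ, ∫⁻ r : ℝ, Φ (Fin.snoc (α := fun _ => ℝ) t r) := by
        rw [Measure.volume_eq_prod, lintegral_prod_symm']
        refine hΦm.comp (measurable_pi_lambda _ fun i => ?_)
        refine Fin.lastCases ?_ (fun j => ?_) i
        · simp only [Fin.snoc_last]; fun_prop
        · simp only [Fin.snoc_castSucc]; fun_prop
    -- The last free holding time is replaced by the time `u` at which it ends.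
    _ = ∫⁻ t : Fin n → ℝ, ∫⁻ u : ℝ, Φ (Fin.snoc (α := fun _ => ℝ) t (u - ∑ i, t i)) :=
        lintegral_congr fun t => (lintegral_sub_right_eq_self
          (fun r => Φ (Fin.snoc (α := fun _ => ℝ) t r)) (∑ i, t i)).symm
    _ = ∫⁻ u : ℝ, ∫⁻ t : Fin n → ℝ, Φ (Fin.snoc (α := fun _ => ℝ) t (u - ∑ i, t i)) :=
        lintegral_lintegral_swap
          ((hΦm.comp (hsnoc.comp measurable_swap)).aemeasurable)
    _ = ∫⁻ u in Icc 0 s, ENNReal.ofReal (Real.exp ((s - u) * g (Fin.last _))) *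
        occupationLIntegral (Fin.init g) (Fin.init h) u
          (fun y => F (y + (s - u) * h (Fin.last _))) := by
        rw [← lintegral_indicator measurableSet_Icc]
        refine lintegral_congr fun u => ?_
        simp_rw [hind]
        by_cases hu : u ∈ Icc 0 s
        · simp only [indicator_of_mem hu, occupationLIntegral]
          rw [lintegral_const_mul' _ _ ENNReal.ofReal_ne_top,
            lintegral_indicator (measurableSet_cornerSimplex _ _)]
        · simp [indicator_of_notMem hu]
    _ = _ := by rw [Measure.restrict_congr_set Ioc_ae_eq_Icc]

lemma occupationLIntegral_eq_lintegral_pathDensity : ∀ (n : ℕ) (g h : Fin (n + 2) → ℝ)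
    (_ : h 0 ≠ h 1) {s : ℝ} (_ : 0 ≤ s) {F : ℝ → ℝ≥0∞} (_ : Measurable F),
    occupationLIntegral g h s F = ∫⁻ x, ENNReal.ofReal (pathDensity (n + 1) g h s x) * F x
  | 0, g, h, h01, s, hs, F, hF => by
      have hc : h 0 - h 1 ≠ 0 := sub_ne_zero.2 h01
      have h1 := lintegral_comp_mul_add
        (fun x => ENNReal.ofReal (pathDensity 1 g h s x) * F x) hc (s * h 1)
      have hc' : ENNReal.ofReal |h 0 - h 1| * ENNReal.ofReal |h 0 - h 1|⁻¹ = 1 := by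
        rw [← ENNReal.ofReal_mul (abs_nonneg _), mul_inv_cancel₀ (abs_ne_zero.2 hc),
          ENNReal.ofReal_one]
      rw [← one_mul (∫⁻ x, ENNReal.ofReal (pathDensity (0 + 1) g h s x) * F x), ← hc', mul_assoc,
        ← h1, ← lintegral_const_mul' _ _ ENNReal.ofReal_ne_top, occupationLIntegral_succ _ _ _ _ hF,
        Measure.restrict_congr_set Ioc_ae_eq_Icc, ← lintegral_indicator measurableSet_Icc]
      refine lintegral_congr fun t => ?_
      have ht' : (t * (h 0 - h 1) + s * h 1 - s * h 1) / (h 0 - h 1) = t := by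
        field_simp; ring
      rw [pathDensity_one, ht']
      by_cases ht : t ∈ Icc 0 s
      · rw [indicator_of_mem ht, indicator_of_mem ht, occupationLIntegral_zero _ _ ht.1,
          ← mul_assoc, ← mul_assoc, ← ENNReal.ofReal_mul (Real.exp_nonneg _),
          ← ENNReal.ofReal_mul (abs_nonneg _), ← Real.exp_add]
        have e1 : |h 0 - h 1| * (Real.exp (t * g 0 + (s - t) * g 1) * |h 0 - h 1|⁻¹) =
            Real.exp (t * g 0 + (s - t) * g 1) := by
          field_simp
        rw [e1]
        congr 2
        · rw [add_comm]; rfl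
        · simp only [Fin.init]
          change t * h 0 + (s - t) * h 1 = _
          ring
      · rw [indicator_of_notMem ht, indicator_of_notMem ht]
        simp
  | n + 1, g, h, h01, s, hs, F, hF => by
      have hk : Measurable fun p : ℝ × ℝ => ENNReal.ofReal (Real.exp ((s - p.1) * g (Fin.last _)) *
          pathDensity (n + 1) (Fin.init g) (Fin.init h) p.1
            (p.2 - (s - p.1) * h (Fin.last _))) :=
        (Measurable.mul (by fun_prop) (measurable_pathDensity_comp _ _ _ (by fun_prop)
          (by fun_prop))).ennreal_ofReal
      calc occupationLIntegral g h s F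
          = ∫⁻ u in Ioc 0 s, ∫⁻ x, ENNReal.ofReal (Real.exp ((s - u) * g (Fin.last _)) *
              pathDensity (n + 1) (Fin.init g) (Fin.init h) u
                (x - (s - u) * h (Fin.last _))) * F x := by
            rw [occupationLIntegral_succ _ _ _ _ hF]
            refine setLIntegral_congr_fun measurableSet_Ioc fun u hu => ?_
            rw [occupationLIntegral_eq_lintegral_pathDensity n (Fin.init g) (Fin.init h) h01
              hu.1.le (by fun_prop), ← lintegral_const_mul' _ _ ENNReal.ofReal_ne_top,
              ← lintegral_sub_right_eq_self _ ((s - u) * h (Fin.last _))]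
            refine lintegral_congr fun x => ?_
            rw [ENNReal.ofReal_mul (Real.exp_nonneg _), sub_add_cancel, mul_assoc]
        _ = ∫⁻ x, ∫⁻ u in Ioc 0 s, ENNReal.ofReal (Real.exp ((s - u) * g (Fin.last _)) *
              pathDensity (n + 1) (Fin.init g) (Fin.init h) u
                (x - (s - u) * h (Fin.last _))) * F x :=
            lintegral_lintegral_swap (hk.mul (hF.comp measurable_snd)).aemeasurable
        _ = _ := by
            refine lintegral_congr fun x => ?_
            have hkx := hk.comp (measurable_prodMk_right (y := x))
            simp only [Function.comp_def] at hkx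
            rw [lintegral_mul_const _ hkx,
              pathDensity_add_two, ofReal_integral_eq_lintegral_ofReal]
            · exact integrableOn_pathDensity_integrand n g h s x
            · exact ae_of_all _ fun u =>
                mul_nonneg (Real.exp_nonneg _) (pathDensity_nonneg _ _ _ _ _)

/-- On the simplex of size one, `pathDensity` is the density of `(1 / n!) η^{g;h}`. -/
lemma inv_factorial_smul_etaMeasure (n : ℕ) (g h : Fin (n + 2) → ℝ) (h01 : h 0 ≠ h 1) :
    ((n + 1).factorial : ℝ≥0∞)⁻¹ • etaMeasure g h =
      volume.withDensity fun x => ENNReal.ofReal (pathDensity (n + 1) g h 1 x) := by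
  ext S hS
  have hm : ∀ k : Fin (n + 2) → ℝ, Measurable fun t : Fin (n + 2) → ℝ => ∑ i, t i * k i :=
    fun k => by fun_prop
  have hF : Measurable (S.indicator (1 : ℝ → ℝ≥0∞)) := measurable_one.indicator hS
  have hfac : ((n + 1).factorial : ℝ≥0∞)⁻¹ * ((n + 1).factorial : ℝ≥0∞) = 1 :=
    ENNReal.inv_mul_cancel (by exact_mod_cast (Nat.factorial_pos _).ne') (by simp)
  have h1 : etaMeasure g h S = ((n + 1).factorial : ℝ≥0∞) *
      occupationLIntegral g h 1 (S.indicator 1) := by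
    rw [etaMeasure, Measure.map_apply (hm h) hS, tiltedSimplex,
      withDensity_apply _ (hm h hS), ← lintegral_indicator (hm h hS), simplexUniform_eq,
      lintegral_map ?_ (measurable_holdingTimes 1), lintegral_smul_measure]
    · rw [occupationLIntegral, smul_eq_mul]
      congr 1
      refine lintegral_congr fun t => ?_
      by_cases ht : (∑ i, holdingTimes 1 t i * h i) ∈ S
      · rw [indicator_of_mem ht, Pi.one_apply, mul_one]
        exact indicator_of_mem (s := (fun t : Fin (n + 2) → ℝ => ∑ i, t i * h i) ⁻¹' S) ht _
      · rw [indicator_of_notMem ht, mul_zero]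
        exact indicator_of_notMem (s := (fun t : Fin (n + 2) → ℝ => ∑ i, t i * h i) ⁻¹' S) ht _
    · exact ((hm g).exp.ennreal_ofReal).indicator (hm h hS)
  rw [Measure.smul_apply, h1, smul_eq_mul, ← mul_assoc, hfac, one_mul,
    occupationLIntegral_eq_lintegral_pathDensity n g h h01 zero_le_one hF, withDensity_apply _ hS,
    ← lintegral_indicator hS]
  refine lintegral_congr fun x => ?_
  by_cases hx : x ∈ S <;> simp [hx]

/-! ### Laplace transforms of the densities -/

/-- The iterated convolution on `[0, s]` of the exponentials `u ↦ exp (u * c i)`, that is, the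
integral of `exp (∑ tᵢ cᵢ)` over the simplex `{t | tᵢ ≥ 0, ∑ tᵢ = s}`. -/
noncomputable def pathExp : (n : ℕ) → (Fin (n + 1) → ℂ) → ℝ → ℂ
  | 0, c, s => Complex.exp (s * c 0)
  | n + 1, c, s => ∫ u in (0 : ℝ)..s, pathExp n (Fin.init c) u *
      Complex.exp ((s - u) * c (Fin.last _))

lemma pathExp_zero (c : Fin 1 → ℂ) (s : ℝ) : pathExp 0 c s = Complex.exp (s * c 0) := by
  rw [pathExp]

lemma pathExp_succ (n : ℕ) (c : Fin (n + 2) → ℂ) (s : ℝ) : pathExp (n + 1) c s =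
    ∫ u in (0 : ℝ)..s, pathExp n (Fin.init c) u * Complex.exp ((s - u) * c (Fin.last _)) := by
  rw [pathExp]

lemma continuous_intervalIntegral_mul_exp {f : ℝ → ℂ} (hf : Continuous f) (c : ℂ) :
    Continuous fun s : ℝ => ∫ u in (0 : ℝ)..s, f u * Complex.exp ((s - u) * c) := by
  have : (fun s : ℝ => ∫ u in (0 : ℝ)..s, f u * Complex.exp ((s - u) * c)) =
      fun s : ℝ => Complex.exp (s * c) * ∫ u in (0 : ℝ)..s, f u * Complex.exp (-u * c) := by
    ext s
    rw [← intervalIntegral.integral_const_mul]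
    congr 1
    ext u
    rw [sub_mul, sub_eq_add_neg, Complex.exp_add, neg_mul]
    ring
  rw [this]
  refine Continuous.mul (by fun_prop) ?_
  exact intervalIntegral.continuous_primitive
    (fun a b => Continuous.intervalIntegrable (by fun_prop) a b) 0

lemma continuous_pathExp : ∀ (n : ℕ) (c : Fin (n + 1) → ℂ), Continuous (pathExp n c)
  | 0, c => by
      rw [funext (pathExp_zero c)]
      fun_prop
  | n + 1, c => by
      rw [funext (pathExp_succ n c)]
      exact continuous_intervalIntegral_mul_exp (continuous_pathExp n _) _

lemma integrable_exp_mul_pathDensity_integrand (n : ℕ) (g h : Fin (n + 3) → ℝ) (s : ℝ) (z : ℂ) :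
    Integrable (fun p : ℝ × ℝ => Complex.exp (-z * p.1) *
      ((Real.exp ((s - p.2) * g (Fin.last _)) * pathDensity (n + 1) (Fin.init g) (Fin.init h) p.2
        (p.1 - (s - p.2) * h (Fin.last _)) : ℝ) : ℂ))
      ((volume : Measure ℝ).prod (volume.restrict (Ioc 0 s))) := by
  obtain ⟨G, hG⟩ := (Set.finite_range g).bddAbove
  obtain ⟨lo, hlo⟩ := (Set.finite_range h).bddBelow
  obtain ⟨hi, hhi⟩ := (Set.finite_range h).bddAbove
  have hh : ∀ i, h i ∈ Icc lo hi := fun i => ⟨hlo (mem_range_self i), hhi (mem_range_self i)⟩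
  have ha : Integrable ((Icc (s * lo) (s * hi)).indicator fun x : ℝ => ‖Complex.exp (-z * x)‖) :=
    (Continuous.integrableOn_Icc (by fun_prop)).integrable_indicator measurableSet_Icc
  have hb : Integrable (fun u : ℝ => Real.exp ((s - u) * g (Fin.last _)) *
      (|h 0 - h 1|⁻¹ * Real.exp (u * G) * (u ^ n / n.factorial))) (volume.restrict (Ioc 0 s)) :=
    (Continuous.integrableOn_Icc (by fun_prop)).mono_set Ioc_subset_Icc_self
  refine (ha.mul_prod hb).mono' ?_ ?_
  · refine (Measurable.mul (by fun_prop) (Measurable.complex_ofReal ?_)).aestronglyMeasurable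
    exact Measurable.mul (by fun_prop) (measurable_pathDensity_comp _ _ _ (by fun_prop)
      (by fun_prop))
  · have hmem : ∀ᵐ p ∂((volume : Measure ℝ).prod (volume.restrict (Ioc 0 s))), p.2 ∈ Ioc 0 s :=
      Measure.quasiMeasurePreserving_snd.ae (ae_restrict_mem measurableSet_Ioc)
    filter_upwards [hmem] with p hp
    have hk := pathDensity_nonneg (n + 1) (Fin.init g) (Fin.init h) p.2
      (p.1 - (s - p.2) * h (Fin.last _))
    rw [norm_mul, Complex.norm_real, Real.norm_of_nonneg (mul_nonneg (Real.exp_nonneg _) hk)]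
    by_cases hx : p.1 ∈ Icc (s * lo) (s * hi)
    · rw [indicator_of_mem hx]
      refine mul_le_mul_of_nonneg_left (mul_le_mul_of_nonneg_left ?_ (Real.exp_nonneg _))
        (norm_nonneg _)
      exact pathDensity_le n (Fin.init g) (Fin.init h) (fun i => hG (mem_range_self _)) hp.1.le _
    · rw [pathDensity_eq_zero (n + 1) (Fin.init g) (Fin.init h) (fun i => hh _),
        indicator_of_notMem hx]
      · simp
      · intro hu'
        have h2 := sub_nonneg.2 hp.2
        refine hx ⟨?_, ?_⟩ <;> nlinarith [hu'.1, hu'.2,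
          mul_le_mul_of_nonneg_left (hh (Fin.last _)).1 h2,
          mul_le_mul_of_nonneg_left (hh (Fin.last _)).2 h2]

/-- The Laplace transform of `pathDensity` in the space variable. -/
lemma integral_exp_mul_pathDensity (z : ℂ) : ∀ (n : ℕ) (g h : Fin (n + 2) → ℝ) (_ : h 0 ≠ h 1)
    {s : ℝ} (_ : 0 ≤ s),
    ∫ x : ℝ, Complex.exp (-z * x) * (pathDensity (n + 1) g h s x : ℂ) =
      pathExp (n + 1) (fun i => g i - z * h i) s
  | 0, g, h, h01, s, hs => by
      have hc : h 0 - h 1 ≠ 0 := sub_ne_zero.2 h01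
      set Ψ : ℝ → ℂ := fun x => Complex.exp (-z * x) * (pathDensity 1 g h s x : ℂ) with hΨ
      have h1 : ∫ t : ℝ, Ψ (t * (h 0 - h 1) + s * h 1) = |h 0 - h 1|⁻¹ • ∫ x, Ψ x := by
        rw [Measure.integral_comp_mul_right (fun y => Ψ (y + s * h 1)),
          integral_add_right_eq_self Ψ, abs_inv]
      have h2 : ∫ x, Ψ x = |h 0 - h 1| • ∫ t : ℝ, Ψ (t * (h 0 - h 1) + s * h 1) := by
        rw [h1, smul_smul, mul_inv_cancel₀ (abs_ne_zero.2 hc), one_smul]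
      change ∫ x, Ψ x = _
      rw [h2, ← integral_smul, pathExp_succ, intervalIntegral.integral_of_le hs,
        ← integral_Icc_eq_integral_Ioc, ← integral_indicator measurableSet_Icc]
      congr 1
      ext t
      have ht' : (t * (h 0 - h 1) + s * h 1 - s * h 1) / (h 0 - h 1) = t := by
        field_simp; ring
      rw [hΨ]
      simp only [pathDensity_one, ht']
      by_cases ht : t ∈ Icc 0 s
      · rw [indicator_of_mem ht, indicator_of_mem ht, pathExp_zero, ← Complex.exp_add,
          Complex.real_smul]
        have e1 : ((|h 0 - h 1| : ℝ) : ℂ) ≠ 0 := by exact_mod_cast abs_ne_zero.2 hc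
        push_cast
        rw [mul_left_comm, mul_comm (Complex.exp (t * g 0 + (s - t) * g 1)),
          mul_inv_cancel_left₀ e1, ← Complex.exp_add]
        congr 1
        simp only [Fin.init, Fin.castSucc_zero]
        change _ = (t : ℂ) * (g 0 - z * h 0) + (s - t) * (g 1 - z * h 1)
        ring
      · rw [indicator_of_notMem ht, indicator_of_notMem ht]
        simp
  | n + 1, g, h, h01, s, hs => by
      calc ∫ x : ℝ, Complex.exp (-z * x) * (pathDensity (n + 2) g h s x : ℂ)
          = ∫ x : ℝ, ∫ u in Ioc 0 s, Complex.exp (-z * x) *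
              ((Real.exp ((s - u) * g (Fin.last _)) * pathDensity (n + 1) (Fin.init g) (Fin.init h)
                u (x - (s - u) * h (Fin.last _)) : ℝ) : ℂ) := by
            congr 1
            ext x
            rw [integral_const_mul, pathDensity_add_two]
            congr 1
            exact integral_ofReal.symm
        _ = ∫ u in Ioc 0 s, ∫ x : ℝ, Complex.exp (-z * x) *
              ((Real.exp ((s - u) * g (Fin.last _)) * pathDensity (n + 1) (Fin.init g) (Fin.init h)
                u (x - (s - u) * h (Fin.last _)) : ℝ) : ℂ) :=
            integral_integral_swap (integrable_exp_mul_pathDensity_integrand n g h s z)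
        _ = ∫ u in Ioc 0 s, pathExp (n + 1) (Fin.init fun i => g i - z * h i) u *
              Complex.exp ((s - u) * (g (Fin.last _) - z * h (Fin.last _))) := by
            refine setIntegral_congr_fun measurableSet_Ioc fun u hu => ?_
            have ih := integral_exp_mul_pathDensity z n (Fin.init g) (Fin.init h) h01 hu.1.le
            change _ = pathExp (n + 1) (fun i => Fin.init g i - z * Fin.init h i) u * _
            rw [← ih, ← integral_mul_const, ← integral_add_right_eq_self _
              ((s - u) * h (Fin.last _))]
            congr 1
            ext y
            rw [add_sub_cancel_right]
            push_cast
            have e1 : Complex.exp (-z * (y + (s - u) * h (Fin.last _))) *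
                Complex.exp ((s - u) * g (Fin.last _)) = Complex.exp (-z * y) *
                Complex.exp ((s - u) * (g (Fin.last _) - z * h (Fin.last _))) := by
              rw [← Complex.exp_add, ← Complex.exp_add]; ring_nf
            rw [← mul_assoc, e1]
            ring
        _ = _ := by rw [pathExp_succ, intervalIntegral.integral_of_le hs]

/-! ### The Dyson series as a sum over paths -/

section Dyson

/-- The integral operator of Duhamel's formula for a perturbation `V` of the diagonal matrix with
entries `c`; row vectors depending on time are functions `Fin d → ℝ → ℂ`. -/
noncomputable def duhamel {d : ℕ} (V : Matrix (Fin d) (Fin d) ℂ) (c : Fin d → ℂ)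
    (F : Fin d → ℝ → ℂ) : Fin d → ℝ → ℂ :=
  fun j s => ∫ u in (0 : ℝ)..s, (∑ l, F l u * V l j) * Complex.exp ((s - u) * c j)

variable {d : ℕ} (V : Matrix (Fin d) (Fin d) ℂ) (c : Fin d → ℂ)

lemma continuous_duhamel {F : Fin d → ℝ → ℂ} (hF : ∀ j, Continuous (F j)) (j : Fin d) :
    Continuous (duhamel V c F j) :=
  continuous_intervalIntegral_mul_exp (by fun_prop) _

lemma continuous_duhamel_iterate {F : Fin d → ℝ → ℂ} (hF : ∀ j, Continuous (F j)) (n : ℕ) :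
    ∀ j, Continuous ((duhamel V c)^[n] F j) := by
  induction n with
  | zero => simpa using hF
  | succ n ih =>
    intro j
    rw [Function.iterate_succ_apply']
    exact continuous_duhamel V c ih j

lemma duhamel_add {F G : Fin d → ℝ → ℂ} (hF : ∀ j, Continuous (F j))
    (hG : ∀ j, Continuous (G j)) : duhamel V c (F + G) = duhamel V c F + duhamel V c G := by
  ext j s
  simp only [duhamel, Pi.add_apply]
  rw [← intervalIntegral.integral_add]
  · congr 1
    ext u
    rw [← add_mul, ← Finset.sum_add_distrib]
    simp only [add_mul]
  · exact Continuous.intervalIntegrable (by fun_prop) _ _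
  · exact Continuous.intervalIntegrable (by fun_prop) _ _

lemma duhamel_iterate_add {F G : Fin d → ℝ → ℂ} (hF : ∀ j, Continuous (F j))
    (hG : ∀ j, Continuous (G j)) (n : ℕ) :
    (duhamel V c)^[n] (F + G) = (duhamel V c)^[n] F + (duhamel V c)^[n] G := by
  induction n with
  | zero => rfl
  | succ n ih =>
    simp only [Function.iterate_succ_apply', ih]
    exact duhamel_add V c (continuous_duhamel_iterate V c hF n)
      (continuous_duhamel_iterate V c hG n)

/-- Iterating Duhamel's formula: the partial sums of the Dyson series, with remainder. -/
lemma eq_sum_duhamel_iterate {X F : Fin d → ℝ → ℂ} (hX : ∀ j, Continuous (X j))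
    (hF : ∀ j, Continuous (F j)) (h : X = F + duhamel V c X) (n : ℕ) (j : Fin d) (s : ℝ) :
    X j s = ∑ k ∈ Finset.range n, (duhamel V c)^[k] F j s + (duhamel V c)^[n] X j s := by
  induction n with
  | zero => simp
  | succ n ih =>
    rw [ih, Finset.sum_range_succ, Function.iterate_succ_apply, add_assoc]
    congr 1
    conv_lhs => rw [h, duhamel_iterate_add V c hF (continuous_duhamel V c hX)]
    rfl

/-- The `n`-th application of the Duhamel operator gains a factor proportional to `s / n`, which
makes the Dyson series converge and its remainder vanish. -/
lemma norm_duhamel_iterate_le {F : Fin d → ℝ → ℂ} {K : ℝ}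
    (hK : ∀ j, ∀ s ∈ Icc (0 : ℝ) 1, ‖F j s‖ ≤ K) (n : ℕ) :
    ∀ j, ∀ s ∈ Icc (0 : ℝ) 1, ‖(duhamel V c)^[n] F j s‖ ≤
      K * ((∑ l, ∑ j, ‖V l j‖) * Real.exp (∑ j, ‖c j‖)) ^ n * (s ^ n / n.factorial) := by
  set C := (∑ l, ∑ j, ‖V l j‖) * Real.exp (∑ j, ‖c j‖) with hC
  induction n with
  | zero => simpa using hK
  | succ n ih =>
    intro j s hs
    rw [Function.iterate_succ_apply']
    have hpt : ∀ u ∈ Ioc 0 s, ‖(∑ l, (duhamel V c)^[n] F l u * V l j) *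
        Complex.exp ((s - u) * c j)‖ ≤ K * C ^ (n + 1) * (u ^ n / n.factorial) := by
      intro u hu
      have hu1 : u ∈ Icc (0 : ℝ) 1 := ⟨hu.1.le, hu.2.trans hs.2⟩
      have hexp : ‖Complex.exp ((s - u) * c j)‖ ≤ Real.exp (∑ j, ‖c j‖) := by
        refine (Complex.norm_exp_le_exp_norm _).trans (Real.exp_le_exp.2 ?_)
        have h1 : ‖((s : ℂ) - u)‖ ≤ 1 := by
          rw [← Complex.ofReal_sub, Complex.norm_real, Real.norm_of_nonneg (sub_nonneg.2 hu.2)]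
          linarith [hu.1, hs.2]
        rw [norm_mul]
        calc _ ≤ 1 * ‖c j‖ := by gcongr
          _ ≤ _ := by
            rw [one_mul]
            exact Finset.single_le_sum (f := fun j => ‖c j‖) (fun _ _ => norm_nonneg _)
              (Finset.mem_univ j)
      have hsum : ‖∑ l, (duhamel V c)^[n] F l u * V l j‖ ≤
          K * C ^ n * (u ^ n / n.factorial) * ∑ l, ∑ j, ‖V l j‖ := by
        rw [Finset.mul_sum]
        refine (norm_sum_le _ _).trans (Finset.sum_le_sum fun l _ => ?_)
        rw [norm_mul]
        refine mul_le_mul (ih l u hu1) ?_ (norm_nonneg _) ((norm_nonneg _).trans (ih l u hu1))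
        exact Finset.single_le_sum (f := fun j => ‖V l j‖) (fun _ _ => norm_nonneg _)
          (Finset.mem_univ j)
      rw [norm_mul]
      calc _ ≤ K * C ^ n * (u ^ n / n.factorial) * (∑ l, ∑ j, ‖V l j‖) *
            Real.exp (∑ j, ‖c j‖) :=
            mul_le_mul hsum hexp (norm_nonneg _) ((norm_nonneg _).trans hsum)
        _ = _ := by rw [pow_succ, hC]; ring
    refine (intervalIntegral.norm_integral_le_of_norm_le hs.1 (ae_of_all _ hpt)
      (Continuous.intervalIntegrable (by fun_prop) _ _)).trans_eq ?_
    rw [intervalIntegral.integral_const_mul, intervalIntegral.integral_div, integral_pow,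
      Nat.factorial_succ]
    push_cast
    field_simp
    ring

open scoped Matrix.Norms.Operator in
/-- Duhamel's formula for the `i`-th row of `exp (s (D + V))`, with `D` diagonal. -/
lemma exp_row_eq_add_duhamel (i : Fin d) :
    (fun j (s : ℝ) => NormedSpace.exp (s • (Matrix.diagonal c + V)) i j) =
      (fun j (s : ℝ) => if i = j then Complex.exp (s * c j) else 0) +
      duhamel V c (fun j (s : ℝ) => NormedSpace.exp (s • (Matrix.diagonal c + V)) i j) := by
  set M := Matrix.diagonal c + V with hM
  ext j s
  set X : Fin d → ℝ → ℂ := fun j s => NormedSpace.exp (s • M) i j with hX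
  have hderiv : ∀ j u, HasDerivAt (X j) ((NormedSpace.exp (u • M) * M) i j) u := by
    intro j u
    have h1 := hasDerivAt_exp_smul_const (𝕂 := ℝ) M u
    have h2 := (LinearMap.toContinuousLinearMap
      (Matrix.entryLinearMap ℝ ℂ i j : Matrix (Fin d) (Fin d) ℂ →ₗ[ℝ] ℂ)).hasFDerivAt.comp_hasDerivAt
      u h1
    exact h2
  have hmul : ∀ u, (NormedSpace.exp (u • M) * M) i j = X j u * c j + ∑ l, X l u * V l j := by
    intro u
    rw [hM, mul_add, Matrix.add_apply, Matrix.mul_diagonal, Matrix.mul_apply]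
  have hXc : ∀ j, Continuous (X j) := fun j =>
    continuous_iff_continuousAt.2 fun u => (hderiv j u).continuousAt
  have hexp : ∀ u : ℝ, HasDerivAt (fun u : ℝ => Complex.exp (((s : ℂ) - u) * c j))
      (Complex.exp (((s : ℂ) - u) * c j) * (-1 * c j)) u := by
    intro u
    have h1 : HasDerivAt (fun u : ℝ => ((s : ℂ) - u) * c j) (-1 * c j) u :=
      ((hasDerivAt_id u).ofReal_comp.const_sub (s : ℂ)).mul_const (c j) |>.congr_deriv (by simp)
    exact h1.cexp
  have hprod : ∀ u, HasDerivAt (fun u : ℝ => X j u * Complex.exp (((s : ℂ) - u) * c j))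
      ((∑ l, X l u * V l j) * Complex.exp ((s - u) * c j)) u := by
    intro u
    refine ((hderiv j u).mul (hexp u)).congr_deriv ?_
    rw [hmul]
    ring
  have hftc := intervalIntegral.integral_eq_sub_of_hasDerivAt (a := 0) (b := s)
    (fun u _ => hprod u) (Continuous.intervalIntegrable (by fun_prop) _ _)
  simp only [Pi.add_apply, duhamel]
  rw [hftc]
  have h0 : X j 0 = if i = j then 1 else 0 := by
    simp [hX, Matrix.one_apply]
  rw [h0]
  split_ifs <;> simp [hX]

/-- The product of the entries of `V` along the steps of the word `w`. -/
def edgeProd {n : ℕ} (w : Fin (n + 1) → Fin d) : ℂ := ∏ k : Fin n, V (w k.castSucc) (w k.succ)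

lemma edgeProd_snoc {n : ℕ} (w : Fin (n + 1) → Fin d) (j : Fin d) :
    edgeProd V (Fin.snoc (α := fun _ => Fin d) w j : Fin (n + 2) → Fin d) =
      edgeProd V w * V (w (Fin.last n)) j := by
  rw [edgeProd, Fin.prod_univ_castSucc]
  congr 1
  · refine Finset.prod_congr rfl fun k _ => ?_
    rw [Fin.snoc_castSucc, ← Fin.castSucc_succ, Fin.snoc_castSucc]
  · rw [Fin.snoc_castSucc, Fin.succ_last, Fin.snoc_last]

/-- The terms of the Dyson series as sums over words. -/
lemma duhamel_iterate_eq_sum (i : Fin d) (n : ℕ) (j : Fin d) (s : ℝ) :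
    (duhamel V c)^[n] (fun j s => if i = j then Complex.exp (s * c j) else 0) j s =
      ∑ w : Fin (n + 1) → Fin d, if w 0 = i ∧ w (Fin.last n) = j then
        edgeProd V w * pathExp n (c ∘ w) s else 0 := by
  induction n generalizing j s with
  | zero =>
    rw [← (Equiv.funUnique (Fin 1) (Fin d)).symm.sum_comp]
    simp only [Function.iterate_zero, id_eq, edgeProd, Finset.univ_eq_empty, Finset.prod_empty,
      pathExp_zero, one_mul]
    rw [Finset.sum_eq_single i]
    · rcases eq_or_ne i j with rfl | hij
      · simp
      · simp [hij]
    · intro k _ hk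
      simp [hk]
    · simp
  | succ n ih =>
    rw [Function.iterate_succ_apply', duhamel]
    have hsum : ∀ u, ∑ l, (duhamel V c)^[n]
        (fun j s => if i = j then Complex.exp (s * c j) else 0) l u * V l j =
        ∑ w : Fin (n + 1) → Fin d, if w 0 = i then
          edgeProd V w * V (w (Fin.last n)) j * pathExp n (c ∘ w) u else 0 := by
      intro u
      simp_rw [ih, Finset.sum_mul]
      rw [Finset.sum_comm]
      refine Finset.sum_congr rfl fun w _ => ?_
      rw [Finset.sum_eq_single (w (Fin.last n))]
      · by_cases h : w 0 = i
        · simp [h]; ring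
        · simp [h]
      · intro l _ hl
        rw [if_neg (fun h => hl h.2.symm), zero_mul]
      · simp
    simp_rw [hsum, Finset.sum_mul]
    rw [intervalIntegral.integral_finsetSum]
    · rw [← (Fin.snocEquiv fun _ : Fin (n + 2) => Fin d).sum_comp, Fintype.sum_prod_type,
        Finset.sum_eq_single j]
      · refine Finset.sum_congr rfl fun w _ => ?_
        have h0 : (Fin.snocEquiv fun _ : Fin (n + 2) => Fin d) (j, w) =
          (Fin.snoc (α := fun _ => Fin d) w j : Fin (n + 2) → Fin d) := rfl
        rw [h0]
        have h1 : (Fin.snoc (α := fun _ => Fin d) w j : Fin (n + 2) → Fin d) 0 = w 0 :=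
          Fin.snoc_castSucc (α := fun _ => Fin d) (x := j) (p := w) (i := 0)
        have h2 : Fin.init (c ∘ (Fin.snoc (α := fun _ => Fin d) w j : Fin (n + 2) → Fin d)) =
            c ∘ w := by
          ext k
          simp [Fin.init]
        rw [h1, Fin.snoc_last, edgeProd_snoc, pathExp_succ, h2]
        by_cases h : w 0 = i
        · simp only [h, and_self, if_true, Function.comp_apply, Fin.snoc_last]
          rw [← intervalIntegral.integral_const_mul]
          congr 1
          ext u
          ring
        · simp [h]
      · intro k _ hk
        refine Finset.sum_eq_zero fun w _ => if_neg fun h => hk ?_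
        rw [← h.2]
        exact (Fin.snoc_last (α := fun _ => Fin d) k w).symm
      · simp
    · intro w _
      have := continuous_pathExp n (c ∘ w)
      refine Continuous.intervalIntegrable (Continuous.mul ?_ (by fun_prop)) _ _
      split_ifs
      · fun_prop
      · fun_prop

open scoped Matrix.Norms.Operator in
/-- The Dyson series of `exp (D + V)` as a sum over paths. -/
lemma hasSum_exp_diagonal_add (i j : Fin d) :
    HasSum (fun n : ℕ => ∑ w : Fin (n + 1) → Fin d, if w 0 = i ∧ w (Fin.last n) = j then
        edgeProd V w * pathExp n (c ∘ w) 1 else 0)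
      (NormedSpace.exp (Matrix.diagonal c + V) i j) := by
  set M := Matrix.diagonal c + V with hM
  set X : Fin d → ℝ → ℂ := fun j s => NormedSpace.exp (s • M) i j with hX
  set F : Fin d → ℝ → ℂ := fun j s => if i = j then Complex.exp (s * c j) else 0 with hF
  have hXc : ∀ j, Continuous (X j) := by
    intro j
    have h1 : Continuous fun s : ℝ => NormedSpace.exp (s • M) :=
      continuous_iff_continuousAt.2 fun u =>
        (hasDerivAt_exp_smul_const (𝕂 := ℝ) M u).continuousAt
    exact h1.matrix_elem i j
  have hFc : ∀ j, Continuous (F j) := by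
    intro j
    simp only [hF]
    split_ifs <;> fun_prop
  have hbdd : ∀ G : Fin d → ℝ → ℂ, (∀ j, Continuous (G j)) →
      ∃ K, ∀ j, ∀ s ∈ Icc (0 : ℝ) 1, ‖G j s‖ ≤ K := by
    intro G hG
    choose K hK using fun j => isCompact_Icc.exists_bound_of_continuousOn
      (s := Icc (0 : ℝ) 1) (hG j).continuousOn
    obtain ⟨B, hB⟩ := (Set.finite_range K).bddAbove
    exact ⟨B, fun j s hs => (hK j s hs).trans (hB (mem_range_self j))⟩
  have hiter : ∀ n, (duhamel V c)^[n] F j 1 = ∑ w : Fin (n + 1) → Fin d,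
      if w 0 = i ∧ w (Fin.last n) = j then edgeProd V w * pathExp n (c ∘ w) 1 else 0 :=
    fun n => duhamel_iterate_eq_sum V c i n j 1
  simp_rw [← hiter]
  obtain ⟨K, hK⟩ := hbdd F hFc
  obtain ⟨K', hK'⟩ := hbdd X hXc
  have h1 : (1 : ℝ) ∈ Icc (0 : ℝ) 1 := by simp
  have hsummable : Summable fun n => (duhamel V c)^[n] F j 1 := by
    refine Summable.of_norm_bounded ((Real.summable_pow_div_factorial
      ((∑ l, ∑ j, ‖V l j‖) * Real.exp (∑ j, ‖c j‖))).mul_left K) fun n => ?_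
    refine (norm_duhamel_iterate_le V c hK n j 1 h1).trans_eq ?_
    rw [one_pow]; ring
  have hrem : Tendsto (fun n => (duhamel V c)^[n] X j 1) atTop (𝓝 0) := by
    refine squeeze_zero_norm (fun n => norm_duhamel_iterate_le V c hK' n j 1 h1) ?_
    have := (Real.summable_pow_div_factorial
      ((∑ l, ∑ j, ‖V l j‖) * Real.exp (∑ j, ‖c j‖))).tendsto_atTop_zero.const_mul K'
    rw [mul_zero] at this
    refine this.congr fun n => ?_
    rw [one_pow]; ring
  have hlim : Tendsto (fun n => ∑ k ∈ Finset.range n, (duhamel V c)^[k] F j 1) atTop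
      (𝓝 (X j 1)) := by
    have h2 := (tendsto_const_nhds (x := X j 1)).sub hrem
    rw [sub_zero] at h2
    refine h2.congr fun n => ?_
    rw [eq_sum_duhamel_iterate V c hXc hFc (exp_row_eq_add_duhamel V c i) n j 1,
      add_sub_cancel_right]
  have hval : X j 1 = NormedSpace.exp M i j := by simp [hX]
  rw [← hval, ← tendsto_nhds_unique hsummable.hasSum.tendsto_sum_nat hlim]
  exact hsummable.hasSum

end Dyson

/-! ### The trace as a sum over favorable loops -/

section Trace

variable {d : ℕ} (V : Matrix (Fin d) (Fin d) ℂ) (c : Fin d → ℂ)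

/-- The trace of the Dyson series is a sum over closed words. -/
lemma hasSum_trace_exp_diagonal_add :
    HasSum (fun n : ℕ => ∑ w : Fin (n + 1) → Fin d, if w 0 = w (Fin.last n) then
        edgeProd V w * pathExp n (c ∘ w) 1 else 0)
      (NormedSpace.exp (Matrix.diagonal c + V)).trace := by
  have h := hasSum_sum (s := Finset.univ) fun i _ => hasSum_exp_diagonal_add V c i i
  refine HasSum.congr_fun h fun n => ?_
  rw [Finset.sum_comm]
  refine Finset.sum_congr rfl fun w _ => ?_
  rw [Finset.sum_eq_single (w 0)]
  · simp only [true_and, eq_comm]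
  · intro i _ hi
    exact if_neg fun h => hi h.1.symm
  · simp

/-- The product of the entries of `V` along the cyclic word `γ`. -/
def cyclicProd {n : ℕ} (γ : Fin n → Fin d) : ℂ := ∏ i, V (γ i) (γ (finRotate n i))

lemma snoc_self_succ {m : ℕ} (γ : Fin (m + 1) → Fin d) (k : Fin (m + 1)) :
    (Fin.snoc (α := fun _ => Fin d) γ (γ 0) : Fin (m + 2) → Fin d) k.succ =
      γ (finRotate (m + 1) k) := by
  refine Fin.lastCases ?_ (fun j => ?_) k
  · rw [Fin.succ_last, Fin.snoc_last, finRotate_last]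
  · rw [Fin.succ_castSucc, Fin.snoc_castSucc]
    congr 1
    ext
    rw [coe_finRotate_of_ne_last (Fin.castSucc_lt_last j).ne]
    simp

lemma edgeProd_snoc_self {m : ℕ} (γ : Fin (m + 1) → Fin d) :
    edgeProd V (Fin.snoc (α := fun _ => Fin d) γ (γ 0) : Fin (m + 2) → Fin d) =
      cyclicProd V γ := by
  refine Finset.prod_congr rfl fun k _ => ?_
  rw [snoc_self_succ, Fin.snoc_castSucc]

lemma sum_closed_words_succ {m : ℕ} (f : (Fin (m + 2) → Fin d) → ℂ) :
    (∑ w : Fin (m + 2) → Fin d, if w 0 = w (Fin.last (m + 1)) then f w else 0) =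
      ∑ γ : Fin (m + 1) → Fin d, f (Fin.snoc (α := fun _ => Fin d) γ (γ 0)) := by
  rw [← (Fin.snocEquiv fun _ : Fin (m + 2) => Fin d).sum_comp, Fintype.sum_prod_type,
    Finset.sum_comm]
  refine Finset.sum_congr rfl fun γ _ => ?_
  have h0 : ∀ j, (Fin.snocEquiv fun _ : Fin (m + 2) => Fin d) (j, γ) =
    (Fin.snoc (α := fun _ => Fin d) γ j : Fin (m + 2) → Fin d) := fun _ => rfl
  have h1 : ∀ j, (Fin.snoc (α := fun _ => Fin d) γ j : Fin (m + 2) → Fin d) 0 = γ 0 := fun j =>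
    Fin.snoc_castSucc (α := fun _ => Fin d) (x := j) (p := γ) (i := 0)
  simp_rw [h0, h1, Fin.snoc_last]
  rw [Finset.sum_ite_eq]
  simp

lemma favorableLoops_zero : favorableLoops d 0 = ∅ := by
  ext γ; simp [favorableLoops]

lemma mem_favorableLoops_succ {m : ℕ} {γ : Fin (m + 1) → Fin d} :
    γ ∈ favorableLoops d (m + 1) ↔ ∀ i, γ (finRotate (m + 1) i) ≠ γ i := by
  refine ⟨fun h => h.2, fun h => ⟨?_, h⟩⟩
  rcases m with _ | m
  · exact absurd (congrArg γ (Subsingleton.elim (α := Fin 1) _ _)) (h 0)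
  · omega

/-- For a perturbation with vanishing diagonal only the favorable loops contribute to the trace of
the Dyson series. -/
lemma trace_exp_diagonal_add_eq_tsum (A : Matrix (Fin d) (Fin d) ℂ) (hV : ∀ i, V i i = 0)
    (hVA : ∀ i j, i ≠ j → V i j = A i j)
    (hs : Summable fun γ : FavorableLoop d => γ.ord A * pathExp γ.1 (c ∘ γ.closedWord) 1) :
    (NormedSpace.exp (Matrix.diagonal c + V)).trace =
      ∑ i, Complex.exp (c i) +
        ∑' γ : FavorableLoop d, γ.ord A * pathExp γ.1 (c ∘ γ.closedWord) 1 := by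
  have h := hasSum_trace_exp_diagonal_add V c
  rw [← h.tsum_eq, h.summable.tsum_eq_zero_add, hs.tsum_sigma,
    hs.sigma.tsum_eq_zero_add]
  congr 1
  · simp only [edgeProd, Finset.univ_eq_empty, Finset.prod_empty, pathExp_zero, one_mul]
    rw [← (Equiv.funUnique (Fin 1) (Fin d)).symm.sum_comp]
    refine Finset.sum_congr rfl fun i _ => ?_
    simp
  · have h0 : (∑' γ : favorableLoops d 0, FavorableLoop.ord A ⟨0, γ⟩ *
        pathExp 0 (c ∘ FavorableLoop.closedWord ⟨0, γ⟩) 1) = 0 := by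
      have : IsEmpty (favorableLoops d 0) := by
        rw [favorableLoops_zero]; infer_instance
      exact tsum_empty
    rw [h0, zero_add]
    congr 1
    ext m
    rw [sum_closed_words_succ fun w => edgeProd V w * pathExp (m + 1) (c ∘ w) 1]
    have h1 := tsum_subtype (favorableLoops d (m + 1)) fun γ => cyclicProd A γ *
      pathExp (m + 1) (c ∘ (Fin.snoc (α := fun _ => Fin d) γ (γ 0) : Fin (m + 2) → Fin d)) 1
    refine Eq.trans ?_ h1.symm
    rw [tsum_fintype]
    refine Finset.sum_congr rfl fun γ _ => ?_
    rw [edgeProd_snoc_self]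
    by_cases hγ : γ ∈ favorableLoops d (m + 1)
    · rw [indicator_of_mem hγ]
      congr 1
      exact Finset.prod_congr rfl fun i _ => hVA _ _ (hγ.2 i).symm
    · rw [indicator_of_notMem hγ]
      rw [mem_favorableLoops_succ] at hγ
      push Not at hγ
      obtain ⟨i, hi⟩ := hγ
      have : cyclicProd V γ = 0 :=
        Finset.prod_eq_zero (Finset.mem_univ i) (by rw [hi, hV])
      rw [this, zero_mul]

end Trace

/-! ### Densities of favorable loops -/

namespace FavorableLoop

variable {d : ℕ}

open scoped Classical in
/-- The density `φ(γ, ·)`, normalized to vanish at the points `b i`. -/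
noncomputable def density (a b : Fin d → ℝ) (γ : FavorableLoop d) (x : ℝ) : ℝ :=
  if x ∈ range b then 0 else pathDensity γ.1 (a ∘ γ.closedWord) (b ∘ γ.closedWord) 1 x

variable (a b : Fin d → ℝ)

lemma density_of_mem (γ : FavorableLoop d) {x : ℝ} (hx : x ∈ range b) : density a b γ x = 0 :=
  if_pos hx

lemma density_of_notMem (γ : FavorableLoop d) {x : ℝ} (hx : x ∉ range b) :
    density a b γ x = pathDensity γ.1 (a ∘ γ.closedWord) (b ∘ γ.closedWord) 1 x :=
  if_neg hx

lemma density_nonneg (γ : FavorableLoop d) (x : ℝ) : 0 ≤ density a b γ x := by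
  rw [density]
  split_ifs
  · exact le_rfl
  · exact pathDensity_nonneg _ _ _ _ _

lemma density_ae_eq (γ : FavorableLoop d) : density a b γ =ᵐ[volume]
    pathDensity γ.1 (a ∘ γ.closedWord) (b ∘ γ.closedWord) 1 := by
  have := compl_mem_ae_iff.2 ((finite_range b).measure_zero volume)
  filter_upwards [this] with x hx using density_of_notMem a b γ hx

lemma eventually_nhdsNE_density_eq (γ : FavorableLoop d) (x : ℝ) : ∀ᶠ y in 𝓝[≠] x,
    density a b γ y = pathDensity γ.1 (a ∘ γ.closedWord) (b ∘ γ.closedWord) 1 y := by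
  have h1 : (range b \ {x})ᶜ ∈ 𝓝 x :=
    ((finite_range b).subset sdiff_subset).isClosed.isOpen_compl.mem_nhds (by simp)
  filter_upwards [nhdsWithin_le_nhds h1, self_mem_nhdsWithin] with y hy hyx
  exact density_of_notMem a b γ fun h => hy ⟨h, hyx⟩

lemma measurable_density (γ : FavorableLoop d) : Measurable (density a b γ) := by
  classical
  exact Measurable.ite (finite_range b).measurableSet measurable_const
    (measurable_pathDensity_comp _ _ _ measurable_const measurable_id)

lemma continuousOn_density (γ : FavorableLoop d) :
    ContinuousOn (density a b γ) (range b)ᶜ := by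
  have h : ContinuousOn (pathDensity γ.1 (a ∘ γ.closedWord) (b ∘ γ.closedWord) 1) (range b)ᶜ := by
    refine fun x hx => (continuousAt_pathDensity _ _ _ fun i hi => hx ?_).continuousWithinAt
    exact ⟨γ.closedWord i, by rw [hi, one_mul, Function.comp_apply]⟩
  exact h.congr fun x hx => density_of_notMem a b γ hx

lemma exists_tendsto_density_nhdsGT (γ : FavorableLoop d) (x : ℝ) :
    ∃ l, Tendsto (density a b γ) (𝓝[>] x) (𝓝 l) := by
  obtain ⟨l, hl⟩ := exists_tendsto_pathDensity_nhdsGT γ.1 (a ∘ γ.closedWord) (b ∘ γ.closedWord) 1 x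
  refine ⟨l, hl.congr' ?_⟩
  exact ((eventually_nhdsNE_density_eq a b γ x).filter_mono
    (nhdsWithin_mono x fun y hy => (mem_Ioi.1 hy).ne')).mono fun y hy => hy.symm

lemma exists_tendsto_density_nhdsLT (γ : FavorableLoop d) (x : ℝ) :
    ∃ l, Tendsto (density a b γ) (𝓝[<] x) (𝓝 l) := by
  obtain ⟨l, hl⟩ := exists_tendsto_pathDensity_nhdsLT γ.1 (a ∘ γ.closedWord) (b ∘ γ.closedWord) 1 x
  refine ⟨l, hl.congr' ?_⟩
  exact ((eventually_nhdsNE_density_eq a b γ x).filter_mono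
    (nhdsWithin_mono x fun y hy => (mem_Iio.1 hy).ne)).mono fun y hy => hy.symm

lemma density_eq_zero (γ : FavorableLoop d) {x : ℝ} (hx : x ∉ Icc (⨅ i, b i) (⨆ i, b i)) :
    density a b γ x = 0 := by
  rw [density]
  split_ifs
  · rfl
  · refine pathDensity_eq_zero (lo := ⨅ i, b i) (hi := ⨆ i, b i) _ _ _ (fun i => ⟨?_, ?_⟩) ?_
    · exact ciInf_le (finite_range b).bddBelow _
    · exact le_ciSup (finite_range b).bddAbove _
    · rwa [one_mul, one_mul]

lemma exists_eq_add_two (γ : FavorableLoop d) : ∃ m, γ.1 = m + 2 :=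
  ⟨γ.1 - 2, (Nat.sub_add_cancel γ.2.2.1).symm⟩

lemma closedWord_zero_ne_one {m : ℕ} (γ : favorableLoops d (m + 2)) :
    closedWord ⟨m + 2, γ⟩ 0 ≠ closedWord ⟨m + 2, γ⟩ 1 := by
  have h0 : closedWord ⟨m + 2, γ⟩ 0 = γ.1 0 :=
    Fin.snoc_castSucc (α := fun _ => Fin d) (x := γ.1 0) (p := γ.1) (i := 0)
  have h1 : closedWord ⟨m + 2, γ⟩ 1 = γ.1 (finRotate (m + 2) 0) := snoc_self_succ γ.1 0
  rw [h0, h1]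
  exact (γ.2.2 0).symm

variable {b} in
lemma isLoopDensity_density (hb : Function.Injective b) (γ : FavorableLoop d) :
    IsLoopDensity a b γ (density a b γ) where
  nonneg := density_nonneg a b γ
  continuousOn := continuousOn_density a b γ
  density := by
    have h : (fun x => ENNReal.ofReal (density a b γ x)) =ᵐ[volume] fun x =>
        ENNReal.ofReal (pathDensity γ.1 (a ∘ γ.closedWord) (b ∘ γ.closedWord) 1 x) := by
      filter_upwards [density_ae_eq a b γ] with x hx
      rw [hx]
    rw [withDensity_congr_ae h]
    obtain ⟨n, γ⟩ := γ
    obtain ⟨m, rfl⟩ := exists_eq_add_two ⟨n, γ⟩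
    exact inv_factorial_smul_etaMeasure (m + 1) _ _ (hb.ne (closedWord_zero_ne_one γ))

variable {b} in
lemma integral_exp_mul_density (hb : Function.Injective b) (γ : FavorableLoop d) (z : ℂ) :
    ∫ x : ℝ, Complex.exp (-z * x) * (density a b γ x : ℂ) =
      pathExp γ.1 ((fun i => a i - z * b i) ∘ γ.closedWord) 1 := by
  have h : (fun x : ℝ => Complex.exp (-z * x) * (density a b γ x : ℂ)) =ᵐ[volume] fun x =>
      Complex.exp (-z * x) *
        (pathDensity γ.1 (a ∘ γ.closedWord) (b ∘ γ.closedWord) 1 x : ℂ) := by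
    filter_upwards [density_ae_eq a b γ] with x hx
    rw [hx]
  rw [integral_congr_ae h]
  obtain ⟨n, γ⟩ := γ
  obtain ⟨m, rfl⟩ := exists_eq_add_two ⟨n, γ⟩
  exact integral_exp_mul_pathDensity z (m + 1) _ _ (hb.ne (closedWord_zero_ne_one γ)) zero_le_one

/-- A bound for `φ(γ, ·) |ord(γ)|` which depends only on the length of the loop `γ`. -/
noncomputable def weightBound (A : Matrix (Fin d) (Fin d) ℂ) (a b : Fin d → ℝ) (n : ℕ) : ℝ :=
  (∑ i, ∑ j, |b i - b j|⁻¹) * Real.exp (∑ i, |a i|) *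
    ((∑ i, ∑ j, ‖A i j‖) ^ n / (n - 1).factorial)

lemma norm_density_mul_ord_le (A : Matrix (Fin d) (Fin d) ℂ) (γ : FavorableLoop d) (x : ℝ) :
    ‖(density a b γ x : ℂ) * γ.ord A‖ ≤ weightBound A a b γ.1 := by
  have hdouble : ∀ (f : Fin d → Fin d → ℝ), (∀ i j, 0 ≤ f i j) → ∀ i j,
      f i j ≤ ∑ i, ∑ j, f i j := fun f hf i j =>
    (Finset.single_le_sum (f := f i) (fun j _ => hf i j) (Finset.mem_univ j)).trans
      (Finset.single_le_sum (f := fun i => ∑ j, f i j)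
        (fun i _ => Finset.sum_nonneg fun j _ => hf i j) (Finset.mem_univ i))
  have hord : ‖γ.ord A‖ ≤ (∑ i, ∑ j, ‖A i j‖) ^ γ.1 := by
    rw [ord, norm_prod]
    refine (Finset.prod_le_prod (fun _ _ => norm_nonneg _) fun i _ =>
      hdouble (fun i j => ‖A i j‖) (fun _ _ => norm_nonneg _) _ _).trans_eq ?_
    simp
  have hden : density a b γ x ≤ (∑ i, ∑ j, |b i - b j|⁻¹) * Real.exp (∑ i, |a i|) *
      (1 / (γ.1 - 1).factorial) := by
    rw [density]
    split_ifs
    · positivity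
    · obtain ⟨n, γ⟩ := γ
      obtain ⟨m, rfl⟩ := exists_eq_add_two ⟨n, γ⟩
      refine (pathDensity_le (G := ∑ i, |a i|) (m + 1) _ _ (fun i => ?_) zero_le_one x).trans ?_
      · exact (le_abs_self _).trans (Finset.single_le_sum (f := fun i => |a i|)
          (fun _ _ => abs_nonneg _) (Finset.mem_univ _))
      · rw [one_mul, one_pow]
        refine mul_le_mul_of_nonneg_right (mul_le_mul_of_nonneg_right ?_ (Real.exp_nonneg _))
          (by positivity)
        exact hdouble (fun i j => |b i - b j|⁻¹) (fun _ _ => by positivity) _ _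
  rw [norm_mul, Complex.norm_real, Real.norm_of_nonneg (density_nonneg a b γ x), weightBound]
  calc _ ≤ (∑ i, ∑ j, |b i - b j|⁻¹) * Real.exp (∑ i, |a i|) * (1 / (γ.1 - 1).factorial) *
        (∑ i, ∑ j, ‖A i j‖) ^ γ.1 := by gcongr
    _ = _ := by ring

lemma weightBound_nonneg (A : Matrix (Fin d) (Fin d) ℂ) (n : ℕ) : 0 ≤ weightBound A a b n := by
  unfold weightBound
  positivity

lemma summable_weightBound (A : Matrix (Fin d) (Fin d) ℂ) :
    Summable fun γ : FavorableLoop d => weightBound A a b γ.1 := by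
  refine (summable_sigma_of_nonneg fun γ => weightBound_nonneg a b A γ.1).2
    ⟨fun n => Summable.of_finite, ?_⟩
  set K := ∑ i, ∑ j, ‖A i j‖ with hK
  have hK0 : 0 ≤ K := by positivity
  have hs : Summable fun n : ℕ => (∑ i, ∑ j, |b i - b j|⁻¹) * Real.exp (∑ i, |a i|) *
      ((d * K) ^ n / (n - 1).factorial) := by
    refine Summable.mul_left _ ((summable_nat_add_iff 1).1 ?_)
    simp only [Nat.add_sub_cancel]
    refine ((Real.summable_pow_div_factorial (d * K)).mul_left (d * K)).congr fun n => ?_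
    rw [pow_succ]; ring
  refine Summable.of_nonneg_of_le (fun n => tsum_nonneg fun γ => weightBound_nonneg a b A n)
    (fun n => ?_) hs
  have hcard : (Nat.card (favorableLoops d n) : ℝ) ≤ (d : ℝ) ^ n := by
    have h1 : Nat.card (favorableLoops d n) ≤ Nat.card (Fin n → Fin d) :=
      Finite.card_subtype_le _
    rw [Nat.card_eq_fintype_card (α := Fin n → Fin d), Fintype.card_fun, Fintype.card_fin,
      Fintype.card_fin] at h1
    exact_mod_cast h1
  change ∑' _ : favorableLoops d n, weightBound A a b n ≤ _
  rw [tsum_const, nsmul_eq_mul, weightBound, mul_pow]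
  calc _ ≤ (d : ℝ) ^ n * ((∑ i, ∑ j, |b i - b j|⁻¹) * Real.exp (∑ i, |a i|) *
        (K ^ n / (n - 1).factorial)) := by gcongr
    _ = _ := by ring

end FavorableLoop

/-! ### Signed measures and their Fourier transforms -/

lemma MeasureTheory.Measure.integrable_toSignedMeasure {X E : Type*} [MeasurableSpace X]
    [NormedAddCommGroup E] {μ : Measure X} [IsFiniteMeasure μ] {f : X → E} (hf : Integrable f μ) :
    μ.toSignedMeasure.Integrable f := by
  rwa [VectorMeasure.Integrable, Measure.variation_toSignedMeasure]

lemma integrable_and_integral_withDensityᵥ {X : Type*} [MeasurableSpace X] {μ : Measure X}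
    {ψ : X → ℝ} (hψ : Integrable ψ μ) (hψm : Measurable ψ) {f : X → ℂ}
    (hf : Integrable (fun x => f x * ψ x) μ) (hfm : Measurable f) :
    (μ.withDensityᵥ ψ).Integrable f ∧
      ∫ᵛ x, f x ∂<•(μ.withDensityᵥ ψ) = ∫ x, f x * ψ x ∂μ := by
  have := isFiniteMeasure_withDensity_ofReal hψ.2
  have := isFiniteMeasure_withDensity_ofReal hψ.neg.2
  have hint : ∀ χ : X → ℝ, Measurable χ → (∀ x, |χ x| ≤ |ψ x|) →
      Integrable (fun x => (ENNReal.ofReal (χ x)).toReal • f x) μ := by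
    intro χ hχ hle
    refine hf.norm.mono' (Measurable.aestronglyMeasurable (by fun_prop)) (ae_of_all _ fun x => ?_)
    rw [norm_smul, norm_mul, Complex.norm_real, mul_comm, Real.norm_eq_abs, Real.norm_eq_abs,
      abs_of_nonneg ENNReal.toReal_nonneg]
    refine mul_le_mul_of_nonneg_left ?_ (norm_nonneg _)
    rw [ENNReal.toReal_ofReal']
    exact (max_le (le_abs_self _) (abs_nonneg _)).trans (hle x)
  have hψm' : Measurable fun x => -ψ x := hψm.neg
  have h1 := hint ψ hψm fun _ => le_rfl
  have h2 := hint (fun x => -ψ x) hψm' fun x => (abs_neg _).le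
  have hp : Integrable f (μ.withDensity fun x => ENNReal.ofReal (ψ x)) :=
    (integrable_withDensity_iff_integrable_smul' hψm.ennreal_ofReal
      (ae_of_all _ fun _ => ENNReal.ofReal_lt_top)).2 h1
  have hn : Integrable f (μ.withDensity fun x => ENNReal.ofReal (-ψ x)) :=
    (integrable_withDensity_iff_integrable_smul' hψm'.ennreal_ofReal
      (ae_of_all _ fun _ => ENNReal.ofReal_lt_top)).2 h2
  rw [withDensityᵥ_eq_withDensity_pos_part_sub_withDensity_neg_part hψ]
  refine ⟨(Measure.integrable_toSignedMeasure hp).sub_vectorMeasure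
    (Measure.integrable_toSignedMeasure hn), ?_⟩
  rw [VectorMeasure.integral_sub_vectorMeasure (Measure.integrable_toSignedMeasure hp)
    (Measure.integrable_toSignedMeasure hn), VectorMeasure.integral_toSignedMeasure,
    VectorMeasure.integral_toSignedMeasure,
    integral_withDensity_eq_integral_toReal_smul hψm.ennreal_ofReal
      (ae_of_all _ fun _ => ENNReal.ofReal_lt_top),
    integral_withDensity_eq_integral_toReal_smul hψm'.ennreal_ofReal
      (ae_of_all _ fun _ => ENNReal.ofReal_lt_top), ← integral_sub h1 h2]
  congr 1
  ext x
  rw [← sub_smul, ENNReal.toReal_ofReal', ENNReal.toReal_ofReal', max_zero_sub_max_neg_zero_eq_self,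
    Complex.real_smul, mul_comm]

/-- A finite signed measure on the line is determined by its Fourier transform: by the Jordan
decomposition this reduces to the corresponding fact for finite measures. -/
lemma MeasureTheory.SignedMeasure.ext_of_integral_exp {μ ν : SignedMeasure ℝ}
    (h : ∀ t : ℝ, ∫ᵛ x : ℝ, Complex.exp (t * x * Complex.I) ∂<•μ =
      ∫ᵛ x : ℝ, Complex.exp (t * x * Complex.I) ∂<•ν) : μ = ν := by
  have hint : ∀ (t : ℝ) (κ : Measure ℝ) [IsFiniteMeasure κ],
      Integrable (fun x : ℝ => Complex.exp (t * x * Complex.I)) κ := by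
    intro t κ _
    refine (integrable_const (1 : ℝ)).mono' (Continuous.aestronglyMeasurable (by fun_prop))
      (ae_of_all _ fun x => ?_)
    rw [← Complex.ofReal_mul, Complex.norm_exp_ofReal_mul_I]
  have hdec : ∀ (ρ : SignedMeasure ℝ) (t : ℝ), ∫ᵛ x : ℝ, Complex.exp (t * x * Complex.I) ∂<•ρ =
      charFun ρ.toJordanDecomposition.posPart t - charFun ρ.toJordanDecomposition.negPart t := by
    intro ρ t
    conv_lhs => rw [← ρ.toSignedMeasure_toJordanDecomposition,
      JordanDecomposition.toSignedMeasure]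
    rw [VectorMeasure.integral_sub_vectorMeasure (Measure.integrable_toSignedMeasure (hint t _))
      (Measure.integrable_toSignedMeasure (hint t _)), VectorMeasure.integral_toSignedMeasure,
      VectorMeasure.integral_toSignedMeasure, charFun_apply_real, charFun_apply_real]
  have hadd : ∀ (κ κ' : Measure ℝ) [IsFiniteMeasure κ] [IsFiniteMeasure κ'] (t : ℝ),
      charFun (κ + κ') t = charFun κ t + charFun κ' t := by
    intro κ κ' _ _ t
    simp only [charFun_apply_real]
    exact integral_add_measure (hint t κ) (hint t κ')
  have key : μ.toJordanDecomposition.posPart + ν.toJordanDecomposition.negPart =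
      ν.toJordanDecomposition.posPart + μ.toJordanDecomposition.negPart := by
    refine Measure.ext_of_charFun (funext fun t => ?_)
    rw [hadd, hadd]
    have := h t
    rw [hdec, hdec] at this
    linear_combination this
  rw [← μ.toSignedMeasure_toJordanDecomposition, ← ν.toSignedMeasure_toJordanDecomposition,
    JordanDecomposition.toSignedMeasure, JordanDecomposition.toSignedMeasure,
    sub_eq_sub_iff_add_eq_add, ← Measure.toSignedMeasure_add, ← Measure.toSignedMeasure_add]
  congr 1

lemma IsBMVMeasure.unique {d : ℕ} {A B : Matrix (Fin d) (Fin d) ℂ} {μ ν : SignedMeasure ℝ}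
    (hμ : IsBMVMeasure A B μ) (hν : IsBMVMeasure A B ν) : μ = ν := by
  refine SignedMeasure.ext_of_integral_exp fun t => ?_
  have h1 := (hμ.laplace (-(t * Complex.I))).symm.trans (hν.laplace (-(t * Complex.I)))
  have e : ∀ x : ℝ, Complex.exp (-(-(t * Complex.I)) * x) = Complex.exp (t * x * Complex.I) :=
    fun x => by ring_nf
  simpa only [e] using h1

lemma bmvFunction_conj {d : ℕ} {A : Matrix (Fin d) (Fin d) ℂ} (hA : A.IsHermitian)
    (b : Fin d → ℝ) (z : ℂ) :
    bmvFunction A (Matrix.diagonal fun i => (b i : ℂ)) (starRingEnd ℂ z) =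
      starRingEnd ℂ (bmvFunction A (Matrix.diagonal fun i => (b i : ℂ)) z) := by
  have h : (A - z • Matrix.diagonal fun i => (b i : ℂ)).conjTranspose =
      A - (starRingEnd ℂ z) • Matrix.diagonal fun i => (b i : ℂ) := by
    rw [Matrix.conjTranspose_sub, hA.eq, Matrix.conjTranspose_smul, Matrix.diagonal_conjTranspose]
    congr 3
    ext i
    simp
  rw [bmvFunction, bmvFunction, ← h, Matrix.exp_conjTranspose, Matrix.trace_conjTranspose]
  rfl

/-! ### The loop series and the BMV measure -/

namespace FavorableLoop

variable {d : ℕ} (A : Matrix (Fin d) (Fin d) ℂ) (b : Fin d → ℝ)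

/-- The series `∑ φ(γ, x) ord(γ)` over all favorable loops. -/
noncomputable def loopSeries (x : ℝ) : ℂ :=
  ∑' γ : FavorableLoop d, (density (fun i => (A i i).re) b γ x : ℂ) * γ.ord A

lemma hasSum_loopSeries (x : ℝ) :
    HasSum (fun γ : FavorableLoop d => (density (fun i => (A i i).re) b γ x : ℂ) * γ.ord A)
      (loopSeries A b x) :=
  (Summable.of_norm_bounded (summable_weightBound _ b A)
    fun γ => norm_density_mul_ord_le _ b A γ x).hasSum

lemma loopSeries_of_mem {x : ℝ} (hx : x ∈ range b) : loopSeries A b x = 0 := by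
  simp [loopSeries, density_of_mem _ b _ hx]

lemma loopSeries_eq_zero {x : ℝ} (hx : x ∉ Icc (⨅ i, b i) (⨆ i, b i)) : loopSeries A b x = 0 := by
  simp [loopSeries, density_eq_zero _ b _ hx]

lemma norm_loopSeries_le (x : ℝ) :
    ‖loopSeries A b x‖ ≤ ∑' γ : FavorableLoop d, weightBound A (fun i => (A i i).re) b γ.1 :=
  tsum_of_norm_bounded (summable_weightBound _ b A).hasSum
    fun γ => norm_density_mul_ord_le _ b A γ x

lemma continuousOn_loopSeries : ContinuousOn (loopSeries A b) (range b)ᶜ :=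
  continuousOn_tsum (fun γ => (Complex.continuous_ofReal.comp_continuousOn
    (continuousOn_density _ b γ)).mul continuousOn_const) (summable_weightBound _ b A)
    fun γ x _ => norm_density_mul_ord_le _ b A γ x

/-- Uniform convergence lets one-sided limits pass from the terms to the series. -/
lemma exists_tendsto_loopSeries {l : Filter ℝ}
    (h : ∀ γ : FavorableLoop d, ∃ y, Tendsto (density (fun i => (A i i).re) b γ) l (𝓝 y)) :
    ∃ y, Tendsto (loopSeries A b) l (𝓝 y) := by
  choose y hy using h
  exact ⟨_, tendsto_tsum_of_dominated_convergence (summable_weightBound _ b A)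
    (fun γ => ((Complex.continuous_ofReal.tendsto _).comp (hy γ)).mul_const _)
    (Eventually.of_forall fun x γ => norm_density_mul_ord_le _ b A γ x)⟩

lemma measurable_loopSeries : Measurable (loopSeries A b) := by
  have hs : (loopSeries A b).support ⊆ (range b)ᶜ := fun x hx hxb =>
    hx (loopSeries_of_mem A b hxb)
  classical
  have h : Measurable ((range b)ᶜ.piecewise (loopSeries A b) 0) :=
    (continuousOn_loopSeries A b).measurable_piecewise continuousOn_const
      (finite_range b).measurableSet.compl
  rwa [piecewise_eq_indicator, indicator_eq_self.2 hs] at h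

/-- Termwise integration of the loop series against an exponential. -/
lemma hasSum_integral_exp_mul_loopSeries {b : Fin d → ℝ} (hb : Function.Injective b) (z : ℂ) :
    HasSum (fun γ : FavorableLoop d => γ.ord A *
      pathExp γ.1 ((fun i => ((A i i).re : ℂ) - z * b i) ∘ γ.closedWord) 1)
      (∫ x : ℝ, Complex.exp (-z * x) * loopSeries A b x) := by
  set g : ℝ → ℝ := (Icc (⨅ i, b i) (⨆ i, b i)).indicator fun x => ‖Complex.exp (-z * x)‖ with hg
  have hgi : Integrable g :=
    (Continuous.integrableOn_Icc (by fun_prop)).integrable_indicator measurableSet_Icc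
  have hsum := summable_weightBound (fun i => (A i i).re) b A
  have h := hasSum_integral_of_dominated_convergence (μ := (volume : Measure ℝ))
    (F := fun (γ : FavorableLoop d) (x : ℝ) => Complex.exp (-z * x) *
      ((density (fun i => (A i i).re) b γ x : ℂ) * γ.ord A))
    (f := fun x => Complex.exp (-z * x) * loopSeries A b x)
    (fun γ x => weightBound A (fun i => (A i i).re) b γ.1 * g x) ?_ ?_ ?_ ?_ ?_
  · refine HasSum.congr_fun h fun γ => ?_
    rw [← integral_exp_mul_density (fun i => (A i i).re) hb γ z, mul_comm, ← integral_mul_const]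
    congr 1
    ext x
    ring
  · intro γ
    have := measurable_density (fun i => (A i i).re) b γ
    exact Measurable.aestronglyMeasurable (by fun_prop)
  · refine fun γ => ae_of_all _ fun x => ?_
    by_cases hx : x ∈ Icc (⨅ i, b i) (⨆ i, b i)
    · rw [hg, indicator_of_mem hx, norm_mul, mul_comm]
      exact mul_le_mul_of_nonneg_right (norm_density_mul_ord_le _ b A γ x) (norm_nonneg _)
    · rw [hg, indicator_of_notMem hx, density_eq_zero _ b γ hx]
      simp
  · exact ae_of_all _ fun x => hsum.mul_right _
  · simp_rw [tsum_mul_right]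
    exact hgi.const_mul _
  · exact ae_of_all _ fun x => (hasSum_loopSeries A b x).mul_left _

lemma integrable_continuous_mul_loopSeries {f : ℝ → ℂ} (hf : Continuous f) :
    Integrable fun x => f x * loopSeries A b x := by
  have hgi : Integrable ((Icc (⨅ i, b i) (⨆ i, b i)).indicator fun x => ‖f x‖) :=
    (Continuous.integrableOn_Icc (by fun_prop)).integrable_indicator measurableSet_Icc
  refine (hgi.mul_const
    (∑' γ : FavorableLoop d, weightBound A (fun i => (A i i).re) b γ.1)).mono'
    (hf.measurable.mul (measurable_loopSeries A b)).aestronglyMeasurable (ae_of_all _ fun x => ?_)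
  by_cases hx : x ∈ Icc (⨅ i, b i) (⨆ i, b i)
  · rw [indicator_of_mem hx, norm_mul]
    exact mul_le_mul_of_nonneg_left (norm_loopSeries_le A b x) (norm_nonneg _)
  · simp [indicator_of_notMem hx, loopSeries_eq_zero A b hx]

/-- The Dyson series of the trace in terms of Laplace transforms. -/
lemma bmvFunction_eq {A : Matrix (Fin d) (Fin d) ℂ} (hA : A.IsHermitian) {b : Fin d → ℝ}
    (hb : Function.Injective b) (z : ℂ) :
    bmvFunction A (Matrix.diagonal fun i => (b i : ℂ)) z =
      ∑ i, Complex.exp ((A i i).re - z * b i) +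
        ∫ x : ℝ, Complex.exp (-z * x) * loopSeries A b x := by
  have h := hasSum_integral_exp_mul_loopSeries A hb z
  have hdiag : ∀ i, ((A i i).re : ℂ) = A i i := fun i => hA.coe_re_apply_self i
  have hM : A - z • Matrix.diagonal (fun i => (b i : ℂ)) =
      Matrix.diagonal (fun i => ((A i i).re : ℂ) - z * b i) +
        (A - Matrix.diagonal fun i => A i i) := by
    ext i j
    rcases eq_or_ne i j with rfl | hij
    · simp only [Matrix.sub_apply, Matrix.add_apply, Matrix.smul_apply, Matrix.diagonal_apply_eq,
        smul_eq_mul, hdiag]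
      ring
    · simp [Matrix.diagonal_apply_ne _ hij]
  rw [bmvFunction, hM, trace_exp_diagonal_add_eq_tsum _ _ A ?_ ?_ h.summable, h.tsum_eq]
  · intro i
    simp
  · intro i j hij
    simp [Matrix.diagonal_apply_ne _ hij]

/-- Hermitian symmetry of the trace forces the loop series to be real: the Fourier transform of its
imaginary part vanishes. -/
lemma loopSeries_im {A : Matrix (Fin d) (Fin d) ℂ} (hA : A.IsHermitian) {b : Fin d → ℝ}
    (hb : Function.Injective b) (x : ℝ) : (loopSeries A b x).im = 0 := by
  have hint := fun z : ℂ => integrable_continuous_mul_loopSeries A b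
    (f := fun x : ℝ => Complex.exp (-z * x)) (by fun_prop)
  have hconj : ∀ z : ℂ, ∫ x : ℝ, Complex.exp (-z * x) * starRingEnd ℂ (loopSeries A b x) =
      ∫ x : ℝ, Complex.exp (-z * x) * loopSeries A b x := by
    intro z
    have h1 := bmvFunction_conj hA b (starRingEnd ℂ z)
    rw [Complex.conj_conj, bmvFunction_eq hA hb, bmvFunction_eq hA hb, map_add, map_sum,
      ← integral_conj] at h1
    have h2 : ∑ i, starRingEnd ℂ (Complex.exp ((A i i).re - starRingEnd ℂ z * b i)) =
        ∑ i, Complex.exp ((A i i).re - z * b i) := by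
      refine Finset.sum_congr rfl fun i _ => ?_
      rw [← Complex.exp_conj]
      simp
    rw [h2, add_right_inj] at h1
    rw [h1]
    congr 1
    ext x
    rw [map_mul, ← Complex.exp_conj]
    simp
  have hm : Measurable fun x => (loopSeries A b x).im :=
    Complex.measurable_im.comp (measurable_loopSeries A b)
  have hi : Integrable fun x => (loopSeries A b x).im := by
    have := integrable_continuous_mul_loopSeries A b (f := fun _ => 1) continuous_const
    simp only [one_mul] at this
    exact this.im
  have hzero : volume.withDensityᵥ (fun x => (loopSeries A b x).im) = (0 : SignedMeasure ℝ) := by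
    refine SignedMeasure.ext_of_integral_exp fun t => ?_
    have e : ∀ x : ℝ, Complex.exp (t * x * Complex.I) =
      Complex.exp (-(-(t * Complex.I)) * x) := fun x => by ring_nf
    have him : ∀ x : ℝ, Complex.exp (-(-(t * Complex.I)) * x) * ((loopSeries A b x).im : ℂ) =
        (Complex.exp (-(-(t * Complex.I)) * x) * loopSeries A b x -
          Complex.exp (-(-(t * Complex.I)) * x) * starRingEnd ℂ (loopSeries A b x)) *
          (2 * Complex.I)⁻¹ := by
      intro x
      rw [← mul_sub, Complex.sub_conj]
      field_simp
      push_cast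
      ring
    have hint' : Integrable fun x : ℝ => Complex.exp (-(-(t * Complex.I)) * x) *
        starRingEnd ℂ (loopSeries A b x) := by
      have := measurable_loopSeries A b
      refine (hint (-(t * Complex.I))).mono ?_ (ae_of_all _ fun x => ?_)
      · exact (Measurable.mul (by fun_prop)
          (Complex.continuous_conj.measurable.comp this)).aestronglyMeasurable
      · rw [norm_mul, norm_mul, RCLike.norm_conj]
    have hf : Integrable fun x : ℝ => Complex.exp (t * x * Complex.I) *
        ((loopSeries A b x).im : ℂ) := by
      simp_rw [e, him]
      exact ((hint _).sub hint').mul_const _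
    rw [(integrable_and_integral_withDensityᵥ hi hm hf (by fun_prop)).2,
      VectorMeasure.integral_zero_vectorMeasure]
    simp_rw [e, him]
    rw [integral_mul_const, integral_sub (hint _) hint', hconj, sub_self, zero_mul]
  have hae : (fun x => (loopSeries A b x).im) =ᵐ[volume] fun _ => 0 := by
    refine hi.ae_eq_of_withDensityᵥ_eq (integrable_zero _ _ _) ?_
    rw [hzero]
    exact withDensityᵥ_zero.symm
  by_cases hx : x ∈ range b
  · rw [loopSeries_of_mem A b hx, Complex.zero_im]
  · exact Measure.eqOn_open_of_ae_eq (ae_restrict_of_ae hae)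
      (finite_range b).isClosed.isOpen_compl
      (Complex.continuous_im.comp_continuousOn (continuousOn_loopSeries A b)) continuousOn_const hx

end FavorableLoop

lemma integrable_dirac_vectorMeasure (f : ℝ → ℂ) (hf : Measurable f) (x v : ℝ) :
    (VectorMeasure.dirac x v).Integrable f := by
  rw [VectorMeasure.Integrable, VectorMeasure.variation_dirac]
  exact (integrable_dirac' hf.stronglyMeasurable (by finiteness)).smul_measure (by finiteness)

open FavorableLoop in
theorem theorem2p2 {d : ℕ} (hd : 1 ≤ d) (A : Matrix (Fin d) (Fin d) ℂ) (hA : A.IsHermitian)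
    (b : Fin d → ℝ) (hb : ∀ i, 0 ≤ b i) (hb_inj : Function.Injective b) :
    ∃ μ : SignedMeasure ℝ,
      IsBMVMeasure A (Matrix.diagonal fun i => (b i : ℂ)) μ ∧
      (∀ ν : SignedMeasure ℝ, IsBMVMeasure A (Matrix.diagonal fun i => (b i : ℂ)) ν → ν = μ) ∧
      ∃ (φ : FavorableLoop d → ℝ → ℝ) (ψ : ℝ → ℝ),
        Integrable ψ ∧
        μ = (∑ i, VectorMeasure.dirac (b i) (Real.exp (A i i).re)) + volume.withDensityᵥ ψ ∧
        VectorMeasure.MutuallySingular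
          (∑ i, VectorMeasure.dirac (b i) (Real.exp (A i i).re) : SignedMeasure ℝ)
          (volume : Measure ℝ).toENNRealVectorMeasure ∧
        VectorMeasure.AbsolutelyContinuous
          (volume.withDensityᵥ ψ) (volume : Measure ℝ).toENNRealVectorMeasure ∧
        IsPiecewiseContinuous ψ (range b) ∧
        Function.support ψ ⊆ Icc (⨅ i, b i) (⨆ i, b i) ∧
        (∀ γ, IsLoopDensity (fun i => (A i i).re) b γ (φ γ)) ∧
        ∀ x, HasSum (fun γ => (φ γ x : ℂ) * γ.ord A) (ψ x : ℂ) := by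
  have : Nonempty (Fin d) := ⟨⟨0, hd⟩⟩
  set ψ : ℝ → ℝ := fun x => (loopSeries A b x).re with hψ
  have hψC : ∀ x, (ψ x : ℂ) = loopSeries A b x := fun x =>
    Complex.ext (by simp [hψ]) (by simp [loopSeries_im hA hb_inj x])
  have hψm : Measurable ψ := Complex.measurable_re.comp (measurable_loopSeries A b)
  have hψi : Integrable ψ := by
    have := integrable_continuous_mul_loopSeries A b (f := fun _ => 1) continuous_const
    simp only [one_mul] at this
    exact this.re
  have hψs : Function.support ψ ⊆ Icc (⨅ i, b i) (⨆ i, b i) := by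
    intro x hx
    by_contra hx'
    exact hx (by simp [hψ, loopSeries_eq_zero A b hx'])
  have hlap : ∀ z : ℂ, (volume.withDensityᵥ ψ).Integrable (fun x : ℝ => Complex.exp (-z * x)) ∧
      ∫ᵛ x : ℝ, Complex.exp (-z * x) ∂<•(volume.withDensityᵥ ψ) =
        ∫ x : ℝ, Complex.exp (-z * x) * loopSeries A b x := by
    intro z
    have h := integrable_and_integral_withDensityᵥ hψi hψm
      (f := fun x : ℝ => Complex.exp (-z * x))
    simp_rw [hψC] at h
    exact h (integrable_continuous_mul_loopSeries A b (by fun_prop)) (by fun_prop)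
  have hdirac : ∀ z : ℂ, ∀ i ∈ Finset.univ, (VectorMeasure.dirac (b i)
      (Real.exp (A i i).re)).Integrable (fun x : ℝ => Complex.exp (-z * x)) := fun z i _ =>
    integrable_dirac_vectorMeasure _ (by fun_prop) _ _
  have hBMV : IsBMVMeasure A (Matrix.diagonal fun i => (b i : ℂ))
      ((∑ i, VectorMeasure.dirac (b i) (Real.exp (A i i).re)) + volume.withDensityᵥ ψ) := by
    refine ⟨?_, fun z => ?_, fun z => ?_⟩
    · ext s hs
      rw [VectorMeasure.restrict_apply _ measurableSet_Iio hs]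
      have hm := hs.inter (measurableSet_Iio (a := (0 : ℝ)))
      have h1 : (∑ i, VectorMeasure.dirac (b i) (Real.exp (A i i).re) : SignedMeasure ℝ)
          (s ∩ Iio 0) = 0 := by
        rw [FunLike.coe_sum, Finset.sum_apply]
        refine Finset.sum_eq_zero fun i _ => VectorMeasure.dirac_apply_of_notMem fun h => ?_
        exact (hb i).not_gt h.2
      have h2 : volume.withDensityᵥ ψ (s ∩ Iio 0) = 0 := by
        rw [withDensityᵥ_apply hψi hm]
        refine setIntegral_eq_zero_of_forall_eq_zero fun x hx => ?_
        by_contra h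
        exact ((le_ciInf hb).trans (hψs h).1).not_gt hx.2
      rw [add_apply, h1, h2]
      simp
    · exact (VectorMeasure.Integrable.finsetSum_vectorMeasure (hdirac z)).add_vectorMeasure
        (hlap z).1
    · rw [VectorMeasure.integral_add_vectorMeasure
        (VectorMeasure.Integrable.finsetSum_vectorMeasure (hdirac z)) (hlap z).1,
        VectorMeasure.integral_finsetSum_vectorMeasure (hdirac z), (hlap z).2,
        bmvFunction_eq hA hb_inj]
      congr 1
      refine Finset.sum_congr rfl fun i _ => ?_
      rw [VectorMeasure.integral_dirac]
      simp only [ContinuousLinearMap.flip_apply, ContinuousLinearMap.lsmul_apply,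
        Complex.real_smul, Complex.ofReal_exp, ← Complex.exp_add]
      ring_nf
  refine ⟨_, hBMV, fun ν hν => hν.unique hBMV, fun γ => γ.density (fun i => (A i i).re) b, ψ,
    hψi, rfl, ?_, Measure.withDensityᵥ_absolutelyContinuous _ _, ?_, hψs,
    isLoopDensity_density _ hb_inj, fun x => ?_⟩
  · refine ⟨(range b)ᶜ, (finite_range b).measurableSet.compl, fun t ht => ?_, fun t ht => ?_⟩
    · rw [FunLike.coe_sum, Finset.sum_apply]
      exact Finset.sum_eq_zero fun i _ =>
        VectorMeasure.dirac_apply_of_notMem fun h => ht h (mem_range_self i)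
    · rw [compl_compl] at ht
      have hf := (finite_range b).subset ht
      rw [Measure.toENNRealVectorMeasure_apply_measurable hf.measurableSet, hf.measure_zero]
  · refine ⟨finite_range b,
      Complex.continuous_re.comp_continuousOn (continuousOn_loopSeries A b), fun x _ => ?_,
      fun x _ => ?_⟩
    · obtain ⟨y, hy⟩ := exists_tendsto_loopSeries A b
        fun γ => exists_tendsto_density_nhdsLT (fun i => (A i i).re) b γ x
      exact ⟨_, (Complex.continuous_re.tendsto y).comp hy⟩
    · obtain ⟨y, hy⟩ := exists_tendsto_loopSeries A b
        fun γ => exists_tendsto_density_nhdsGT (fun i => (A i i).re) b γ x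
      exact ⟨_, (Complex.continuous_re.tendsto y).comp hy⟩
  · rw [hψC]
    exact hasSum_loopSeries A b x
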